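/- Write $\mathbb D$ for the open unit disk, let $p(z,w)=z^3-w^2$ (of degree $n=3$ in $z$ and $m=2$ in $w$), $\mathcal Z_p=\{p=0\}\subset\mathbb C^2$, and let $\mathcal N=\mathcal Z_p\cap\mathbb D^2$ be the Neil parabola. For a positive integer $\alpha$, an $\alpha$-admissible pair is a pair $(P,Q)$ of matrix polynomials in $(z,w)$, with $Q$ of size $\alpha\times m\alpha$ and $P$ of size $\alpha\times n\alpha$, each having rank $\alpha$ at some point of each irreducible component of $\mathcal Z_p$, such that $$(1-w\overline\eta)\,Q(z,w)Q(\zeta,\eta)^*=(1-z\overline\zeta)\,P(z,w)P(\zeta,\eta)^*\qquad\text{for all }(z,w),(\zeta,\eta)\in\mathcal Z_p.$$ The corresponding admissible kernel is the $M_\alpha(\mathbb C)$-valued kernel $$K((z,w),(\zeta,\eta))=\frac{Q(z,w)Q(\zeta,\eta)^*}{1-z\overline\zeta}\qquad\text{on }\mathcal N\times\mathcal N.$$ Let $H^\infty_{\mathcal K}(\mathcal N)$ be the algebra of all functions $f:\mathcal N\to\mathbb C$ for which there is an $M>0$ such that for every admissible kernel $K$, of every rank, the kernel $(M^2-f(x)\overline{f(y)})K(x,y)$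 is positive semidefinite on $\mathcal N$; let $\|f\|_{\mathcal N}$ be the infimum of all such $M>0$. Let $\mathcal A=\{g\in H^\infty(\mathbb D): g'(0)=0\}$ with the supremum norm, and $\Psi:\mathbb D\to\mathcal N$, $\Psi(t)=(t^2,t^3)$. (1) The map $\Psi^*f=f\circ\Psi$ is an isometric isomorphism of algebras from $H^\infty_{\mathcal K}(\mathcal N)$ onto $\mathcal A$. (2) For all $a,b\in\mathbb C$ with $|a|^2+|b|^2=1$ put $$k_{a,b}(s,t)=(a+bs)\overline{(a+bt)}+\frac{s^2\overline{t}^2}{1-s\overline t}\qquad(s,t\in\mathbb D).$$ There is a rank one (scalar) admissible kernel $K$ on $\mathcal N$ with $$K(\Psi(s),\Psi(t))=s^2\,k_{a,b}(s,t)\,\overline{t}^2\qquad\text{for all }s,t\in\mathbb D.$$ -/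

import Mathlib

open scoped ComplexOrder ComplexConjugate

noncomputable section

/-- An `M_n(ℂ)`-valued function on `W × W` is positive semidefinite if all the block matrices
that it forms on finite subsets of `W` are positive semidefinite. -/
def IsPSDKernel {W : Type*} {n : ℕ} (k : W → W → Matrix (Fin n) (Fin n) ℂ) : Prop :=
  ∀ F : Finset W,
    (Matrix.of fun a b : F × Fin n => k a.1 b.1 a.2 b.2).PosSemidef

/-- The zero set `Z_p ⊆ ℂ²` of a polynomial in the two variables `z = x 0`, `w = x 1`. -/
def zeroSet (p : MvPolynomial (Fin 2) ℂ) : Set (Fin 2 → ℂ) :=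
  {x | MvPolynomial.eval x p = 0}

/-- The part `Z_p ∩ 𝔻²` of the zero set in the open bidisk. -/
def variety (p : MvPolynomial (Fin 2) ℂ) : Set (Fin 2 → ℂ) :=
  {x | x ∈ zeroSet p ∧ ‖x 0‖ < 1 ∧ ‖x 1‖ < 1}

/-- Value of a matrix polynomial at a point of `ℂ²`. -/
def evalMat {α β : ℕ} (Q : Matrix (Fin α) (Fin β) (MvPolynomial (Fin 2) ℂ)) (x : Fin 2 → ℂ) :
    Matrix (Fin α) (Fin β) ℂ :=
  Q.map (MvPolynomial.eval x)

/-- `(P, Q)` is a rank `α` admissible pair for the polynomial `p` of bidegree `(n, m)`.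
The irreducible components of `Z_p` are the zero loci of the minimal primes over `(p)`.
The identity `Q Q^* / (1 - z conj ζ) = P P^* / (1 - w conj η)` on `Z_p × Z_p` is written without
denominators. -/
structure IsAdmissiblePair (p : MvPolynomial (Fin 2) ℂ) (α : ℕ) {n m : ℕ}
    (P : Matrix (Fin α) (Fin (n * α)) (MvPolynomial (Fin 2) ℂ))
    (Q : Matrix (Fin α) (Fin (m * α)) (MvPolynomial (Fin 2) ℂ)) : Prop where
  rank_pos : 0 < α
  degree_z : p.degreeOf 0 = n
  degree_w : p.degreeOf 1 = m
  rank_Q : ∀ J ∈ (Ideal.span {p}).minimalPrimes,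
    ∃ x ∈ MvPolynomial.zeroLocus ℂ J, (evalMat Q x).rank = α
  rank_P : ∀ J ∈ (Ideal.span {p}).minimalPrimes,
    ∃ x ∈ MvPolynomial.zeroLocus ℂ J, (evalMat P x).rank = α
  identity : ∀ x ∈ zeroSet p, ∀ y ∈ zeroSet p,
    (1 - x 1 * conj (y 1)) • (evalMat Q x * (evalMat Q y).conjTranspose) =
      (1 - x 0 * conj (y 0)) • (evalMat P x * (evalMat P y).conjTranspose)

/-- The kernel `K((z,w),(ζ,η)) = Q(z,w) Q(ζ,η)^* / (1 - z conj ζ)` on `Z_p ∩ 𝔻²`. -/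
def pairKernel (p : MvPolynomial (Fin 2) ℂ) {α β : ℕ}
    (Q : Matrix (Fin α) (Fin β) (MvPolynomial (Fin 2) ℂ)) (x y : variety p) :
    Matrix (Fin α) (Fin α) ℂ :=
  (1 - x.1 0 * conj (y.1 0))⁻¹ • (evalMat Q x.1 * (evalMat Q y.1).conjTranspose)

/-- `K` is an admissible (`M_α`-valued) kernel: it comes from a rank `α` admissible pair. -/
def IsAdmissibleKernel (p : MvPolynomial (Fin 2) ℂ) (α : ℕ)
    (K : variety p → variety p → Matrix (Fin α) (Fin α) ℂ) : Prop :=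
  ∃ (n m : ℕ) (P : Matrix (Fin α) (Fin (n * α)) (MvPolynomial (Fin 2) ℂ))
    (Q : Matrix (Fin α) (Fin (m * α)) (MvPolynomial (Fin 2) ℂ)),
    IsAdmissiblePair p α P Q ∧ K = pairKernel p Q

/-- `(M² - f(x) conj f(y)) K(x, y)` is positive semidefinite for all admissible kernels `K`,
of all ranks. -/
def IsKernelBound (p : MvPolynomial (Fin 2) ℂ) (f : variety p → ℂ) (M : ℝ) : Prop :=
  ∀ (α : ℕ) (K : variety p → variety p → Matrix (Fin α) (Fin α) ℂ), IsAdmissibleKernel p α K →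
    IsPSDKernel fun x y => ((M : ℂ) ^ 2 - f x * conj (f y)) • K x y

/-! Closure properties of positive semidefinite kernels, for the algebra structure below. -/

theorem IsPSDKernel.add {W : Type*} {n : ℕ} {k l : W → W → Matrix (Fin n) (Fin n) ℂ}
    (hk : IsPSDKernel k) (hl : IsPSDKernel l) : IsPSDKernel fun x y => k x y + l x y := by
  intro F
  exact (hk F).add (hl F)

theorem IsPSDKernel.sandwich {W : Type*} {n : ℕ} {k : W → W → Matrix (Fin n) (Fin n) ℂ}
    (hk : IsPSDKernel k) (h : W → ℂ) :
    IsPSDKernel fun x y => (h x * conj (h y)) • k x y := by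
  classical
  intro F
  have := (hk F).mul_mul_conjTranspose_same
    (Matrix.diagonal fun a : F × Fin n => h a.1)
  convert this using 1
  ext a b
  simp [Matrix.diagonal_conjTranspose]
  ring

theorem IsPSDKernel.of_tendsto {W : Type*} {n : ℕ} {k : W → W → Matrix (Fin n) (Fin n) ℂ}
    (u : ℕ → W → W → Matrix (Fin n) (Fin n) ℂ) (hu : ∀ N, IsPSDKernel (u N))
    (h : ∀ x y, Filter.Tendsto (fun N => u N x y) Filter.atTop (nhds (k x y))) :
    IsPSDKernel k := by
  intro F
  have hent : ∀ a b : F × Fin n, Filter.Tendsto (fun N => u N a.1 b.1 a.2 b.2) Filter.atTop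
      (nhds (k a.1 b.1 a.2 b.2)) := fun a b =>
    ((continuous_id.matrix_elem a.2 b.2).tendsto _).comp (h a.1 b.1)
  rw [Matrix.posSemidef_iff_dotProduct_mulVec]
  refine ⟨?_, fun v => ?_⟩
  · ext a b
    have h1 : Filter.Tendsto (fun N => star (u N b.1 a.1 b.2 a.2)) Filter.atTop
        (nhds (star (k b.1 a.1 b.2 a.2))) := (continuous_star.tendsto _).comp (hent b a)
    refine tendsto_nhds_unique h1 ?_
    refine (hent a b).congr fun N => ?_
    have := congrFun (congrFun ((hu N) F).isHermitian a) b
    exact this.symm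
  · refine ge_of_tendsto' (x := Filter.atTop) (f := fun N : ℕ => star v ⬝ᵥ
      ((Matrix.of fun a b : F × Fin n => u N a.1 b.1 a.2 b.2).mulVec v)) ?_ fun N =>
        (Matrix.posSemidef_iff_dotProduct_mulVec.1 ((hu N) F)).2 v
    simp only [dotProduct, Matrix.mulVec, Matrix.of_apply]
    exact tendsto_finsetSum _ fun a _ => tendsto_const_nhds.mul
      (tendsto_finsetSum _ fun b _ => (hent a b).mul tendsto_const_nhds)

theorem isPSDKernel_gram {W : Type*} {n m : ℕ} (q : W → Matrix (Fin n) (Fin m) ℂ) :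
    IsPSDKernel fun x y => q x * (q y).conjTranspose := by
  intro F
  exact Matrix.posSemidef_self_mul_conjTranspose
    (Matrix.of fun (a : F × Fin n) (j : Fin m) => q a.1 a.2 j)

theorem isPSDKernel_pairKernel (p : MvPolynomial (Fin 2) ℂ) {α β : ℕ}
    (Q : Matrix (Fin α) (Fin β) (MvPolynomial (Fin 2) ℂ)) : IsPSDKernel (pairKernel p Q) := by
  refine IsPSDKernel.of_tendsto (fun N x y =>
    (∑ i ∈ Finset.range N, (x.1 0 * conj (y.1 0)) ^ i) •
      (evalMat Q x.1 * (evalMat Q y.1).conjTranspose)) (fun N => ?_) fun x y => ?_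
  · induction N with
    | zero =>
      intro F
      convert Matrix.PosSemidef.zero using 1
      ext a b
      simp
    | succ N ih =>
      have := ih.add ((isPSDKernel_gram fun x : variety p => evalMat Q x.1).sandwich
        fun x => x.1 0 ^ N)
      convert this using 3
      rw [Finset.sum_range_succ, add_smul, mul_pow, map_pow]
  · refine Filter.Tendsto.smul_const (HasSum.tendsto_sum_nat ?_) _
    refine hasSum_geometric_of_norm_lt_one ?_
    rw [norm_mul, RCLike.norm_conj]
    exact mul_lt_one_of_nonneg_of_lt_one_left (norm_nonneg _) x.2.2.1 y.2.2.1.le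

theorem IsAdmissibleKernel.isPSDKernel {p : MvPolynomial (Fin 2) ℂ} {α : ℕ}
    {K : variety p → variety p → Matrix (Fin α) (Fin α) ℂ} (hK : IsAdmissibleKernel p α K) :
    IsPSDKernel K := by
  obtain ⟨n, m, P, Q, -, rfl⟩ := hK
  exact isPSDKernel_pairKernel p Q

theorem IsKernelBound.mul {p : MvPolynomial (Fin 2) ℂ} {f g : variety p → ℂ} {M N : ℝ}
    (hf : IsKernelBound p f M) (hg : IsKernelBound p g N) : IsKernelBound p (f * g) (M * N) := by
  intro α K hK
  have := ((hf α K hK).sandwich fun _ => (N : ℂ)).add ((hg α K hK).sandwich f)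
  convert this using 3
  simp only [smul_smul, ← add_smul, Pi.mul_apply, map_mul, Complex.conj_ofReal]
  congr 1
  push_cast
  ring

theorem IsKernelBound.add {p : MvPolynomial (Fin 2) ℂ} {f g : variety p → ℂ} {M N : ℝ}
    (hM : 0 < M) (hN : 0 < N)
    (hf : IsKernelBound p f M) (hg : IsKernelBound p g N) : IsKernelBound p (f + g) (M + N) := by
  intro α K hK
  set s : ℝ := Real.sqrt (N / M) with hs
  have hs0 : 0 < s := Real.sqrt_pos.2 (div_pos hN hM)
  have hs2 : s ^ 2 = N / M := Real.sq_sqrt (div_pos hN hM).le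
  have hsM : ((s : ℂ)) ^ 2 * M = N := by
    have : s ^ 2 * M = N := by rw [hs2]; field_simp
    exact_mod_cast this
  have hsc : (s : ℂ) ≠ 0 := by exact_mod_cast hs0.ne'
  have hMc : (M : ℂ) ≠ 0 := by exact_mod_cast hM.ne'
  have h1 := ((hf α K hK).add ((hf α K hK).sandwich fun _ => (s : ℂ))).add
    ((hg α K hK).add ((hg α K hK).sandwich fun _ => ((s⁻¹ : ℝ) : ℂ)))
  have h2 := h1.add (hK.isPSDKernel.sandwich fun x => s * f x - ((s⁻¹ : ℝ) : ℂ) * g x)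
  convert h2 using 3
  simp only [smul_smul, ← add_smul, Pi.add_apply, map_mul, map_add, map_sub, Complex.conj_ofReal]
  congr 1
  push_cast
  rw [← hsM]
  field_simp
  ring

theorem isKernelBound_const (p : MvPolynomial (Fin 2) ℂ) (c : ℂ) :
    IsKernelBound p (fun _ => c) (‖c‖ + 1) := by
  intro α K hK
  have h : (0 : ℝ) ≤ (‖c‖ + 1) ^ 2 - ‖c‖ ^ 2 := by nlinarith [norm_nonneg c]
  have := hK.isPSDKernel.sandwich fun _ => ((Real.sqrt ((‖c‖ + 1) ^ 2 - ‖c‖ ^ 2) : ℝ) : ℂ)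
  convert this using 3
  congr 1
  rw [Complex.conj_ofReal, ← Complex.ofReal_mul, Real.mul_self_sqrt h, Complex.mul_conj,
    Complex.normSq_eq_norm_sq]
  push_cast
  ring

/-- The algebra `H^∞_𝒦(Z_p ∩ 𝔻²)` of all functions that have a kernel bound `M > 0`. -/
def HInftyK (p : MvPolynomial (Fin 2) ℂ) : Subalgebra ℂ (variety p → ℂ) where
  carrier := {f | ∃ M : ℝ, 0 < M ∧ IsKernelBound p f M}
  mul_mem' := by
    rintro f g ⟨M, hM, hf⟩ ⟨N, hN, hg⟩
    exact ⟨M * N, mul_pos hM hN, hf.mul hg⟩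
  add_mem' := by
    rintro f g ⟨M, hM, hf⟩ ⟨N, hN, hg⟩
    exact ⟨M + N, add_pos hM hN, hf.add hM hN hg⟩
  algebraMap_mem' c := ⟨‖c‖ + 1, by positivity, isKernelBound_const p c⟩

/-- The norm of `H^∞_𝒦`: the infimum of all kernel bounds. -/
def kernelNorm (p : MvPolynomial (Fin 2) ℂ) (f : variety p → ℂ) : ℝ :=
  sInf {M : ℝ | 0 < M ∧ IsKernelBound p f M}

/-- The open unit disk, as a subset of `ℂ`. -/
abbrev disk : Set ℂ := Metric.ball (0 : ℂ) 1

/-- The algebra `{f ∈ H^∞(𝔻) : f'(0) = 0}` of functions on the disk. -/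
def constrainedHInfty : Subalgebra ℂ (disk → ℂ) where
  carrier := {f | ∃ F : ℂ → ℂ, DifferentiableOn ℂ F disk ∧ (∃ C : ℝ, ∀ t ∈ disk, ‖F t‖ ≤ C) ∧
    deriv F 0 = 0 ∧ ∀ t : disk, f t = F t}
  mul_mem' := by
    rintro f g ⟨F, hF, ⟨C, hC⟩, hF0, hfF⟩ ⟨G, hG, ⟨D, hD⟩, hG0, hgG⟩
    have h0 : disk ∈ nhds (0 : ℂ) := Metric.ball_mem_nhds _ one_pos
    refine ⟨F * G, hF.mul hG, ⟨C * D, fun t ht => ?_⟩, ?_, fun t => ?_⟩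
    · rw [Pi.mul_apply, norm_mul]
      exact mul_le_mul (hC t ht) (hD t ht) (norm_nonneg _) ((norm_nonneg _).trans (hC t ht))
    · rw [deriv_mul (hF.differentiableAt h0) (hG.differentiableAt h0), hF0, hG0]
      simp
    · simp [hfF, hgG]
  add_mem' := by
    rintro f g ⟨F, hF, ⟨C, hC⟩, hF0, hfF⟩ ⟨G, hG, ⟨D, hD⟩, hG0, hgG⟩
    have h0 : disk ∈ nhds (0 : ℂ) := Metric.ball_mem_nhds _ one_pos
    refine ⟨F + G, hF.add hG, ⟨C + D, fun t ht => ?_⟩, ?_, fun t => ?_⟩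
    · exact (norm_add_le _ _).trans (add_le_add (hC t ht) (hD t ht))
    · rw [deriv_add (hF.differentiableAt h0) (hG.differentiableAt h0), hF0, hG0]
      simp
    · simp [hfF, hgG]
  algebraMap_mem' c :=
    ⟨fun _ => c, differentiableOn_const _, ⟨‖c‖, fun _ _ => le_rfl⟩, by simp, fun _ => rfl⟩

/-- The polynomial `z³ - w²`, whose zero set in the bidisk is the Neil parabola. -/
def neilPoly : MvPolynomial (Fin 2) ℂ :=
  MvPolynomial.X 0 ^ 3 - MvPolynomial.X 1 ^ 2

/-- The parametrization `t ↦ (t², t³)` of the Neil parabola by the disk. -/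
def neilParam (t : disk) : variety neilPoly :=
  ⟨![(t : ℂ) ^ 2, (t : ℂ) ^ 3], by
    have ht : ‖(t : ℂ)‖ < 1 := mem_ball_zero_iff.1 t.2
    refine ⟨?_, ?_, ?_⟩
    · simp only [zeroSet, neilPoly, Set.mem_ofPred_eq, map_sub, map_pow, MvPolynomial.eval_X,
        Matrix.cons_val_zero, Matrix.cons_val_one]
      ring
    · simpa using pow_lt_one₀ (norm_nonneg _) ht two_ne_zero
    · simpa using pow_lt_one₀ (norm_nonneg _) ht three_ne_zero⟩

/-- The Davidson–Paulsen–Raghupathi–Singh kernels on the disk. -/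
def dprsKernel (a b : ℂ) (s t : disk) : ℂ :=
  (a + b * s) * conj (a + b * t) + (s : ℂ) ^ 2 * conj (t : ℂ) ^ 2 / (1 - s * conj (t : ℂ))

end

/-! An admissible pair turns `ℓ²(ℕ, ℂ^{2α})`, read as a vector-valued Hardy space, into a space in
which the kernel `K` is the Gram matrix of explicit vectors. These vectors are total
(`IsAdmissiblePair.isTotalFamily`). Multiplication by `z` is the shift `S`; the identity `(1 - w η̄)
K = P P*` makes multiplication by `w` a contraction `T`, and `T² = S³` forces `T` to be isometric
(`IsAdmissiblePair.exists_isCuspPair`).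

Hence every power `t^i` with `i ≠ 1` acts isometrically, and a polynomial `q` with `q'(0) = 0` acts
as an operator `A`. The von Neumann inequality `‖A‖ ≤ sup |q|` (`IsCuspPair.norm_le`) comes from the
subnormal-type estimate `‖A‖² ≤ ‖A²‖`: a coefficient bound for `‖A^(2^n)‖` loses only a factor
linear in `2^n`, which disappears under roots. Dilation and Taylor approximation extend this to all
of `𝒜`.

Conversely, the single pair `Q = (1, w)`, `P = (1, z, z²)` suffices. The diagonal of its kernel
gives `|f| ≤ M`, and membership of `f` in its Hilbert space gives `f(Ψ(t)) = a(t²) + t³ b(t²)`,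
which has no linear term. Thus kernel bounds and sup bounds agree. Part (2) is an explicit pair. -/

open scoped InnerProductSpace

/-! ### Multiplication operators on a Hilbert space with a total family of kernel vectors -/

section Multipliers

variable {X H : Type*} [NormedAddCommGroup H] [InnerProductSpace ℂ H]

/-- A family of vectors is total if only `0` is orthogonal to all of them. -/
def IsTotalFamily (k : X → H) : Prop :=
  ∀ h : H, (∀ x, ⟪k x, h⟫_ℂ = 0) → h = 0

/-- The operator `A` multiplies the values `⟪k x, h⟫` by `φ x`. -/
def IsMultiplier (k : X → H) (φ : X → ℂ) (A : H →L[ℂ] H) : Prop :=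
  ∀ x h, ⟪k x, A h⟫_ℂ = φ x * ⟪k x, h⟫_ℂ

theorem IsMultiplier.comp {k : X → H} {φ ψ : X → ℂ} {A B : H →L[ℂ] H}
    (hA : IsMultiplier k φ A) (hB : IsMultiplier k ψ B) :
    IsMultiplier k (fun x => φ x * ψ x) (A * B) := by
  intro x h
  rw [mul_apply_eq_comp, hA, hB, mul_assoc]

theorem isMultiplier_one (k : X → H) : IsMultiplier k (fun _ => 1) 1 := by
  intro x h
  simp

theorem IsMultiplier.pow {k : X → H} {φ : X → ℂ} {A : H →L[ℂ] H}
    (hA : IsMultiplier k φ A) (n : ℕ) : IsMultiplier k (fun x => φ x ^ n) (A ^ n) := by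
  induction n with
  | zero => simpa using isMultiplier_one k
  | succ n ih => simpa only [pow_succ] using ih.comp hA

theorem IsMultiplier.sum {ι : Type*} {k : X → H} {φ : ι → X → ℂ} {A : ι → H →L[ℂ] H}
    (s : Finset ι) (c : ι → ℂ) (hA : ∀ i ∈ s, IsMultiplier k (φ i) (A i)) :
    IsMultiplier k (fun x => ∑ i ∈ s, c i * φ i x) (∑ i ∈ s, c i • A i) := by
  intro x h
  rw [sum_apply, inner_sum, Finset.sum_mul]
  refine Finset.sum_congr rfl fun i hi => ?_
  rw [smul_apply, inner_smul_right, hA i hi, mul_assoc]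

theorem IsMultiplier.unique {k : X → H} (hk : IsTotalFamily k) {φ ψ : X → ℂ} {A B : H →L[ℂ] H}
    (hA : IsMultiplier k φ A) (hB : IsMultiplier k ψ B) (h : ∀ x, φ x = ψ x) : A = B := by
  ext y
  refine sub_eq_zero.1 (hk _ fun x => ?_)
  rw [inner_sub_right, hA, hB, h, sub_self]

theorem inner_self_eq_ofReal_norm_sq (x : H) : ⟪x, x⟫_ℂ = ((‖x‖ ^ 2 : ℝ) : ℂ) := by
  rw [inner_self_eq_norm_sq_to_K]
  simp

theorem star_dotProduct_gram {ι : Type*} [Fintype ι] (v : ι → H) (c : ι → ℂ) :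
    star c ⬝ᵥ (Matrix.of fun a b => ⟪v a, v b⟫_ℂ).mulVec c = ((‖∑ a, c a • v a‖ ^ 2 : ℝ) : ℂ) := by
  rw [← inner_self_eq_ofReal_norm_sq, sum_inner]
  simp only [dotProduct, Matrix.mulVec, Matrix.of_apply, inner_sum, inner_smul_left,
    inner_smul_right, Pi.star_apply, RCLike.star_def, Finset.mul_sum]
  refine Finset.sum_congr rfl fun a _ => Finset.sum_congr rfl fun b _ => ?_
  ring

/-- The norm inequality of subnormal operators `‖A h‖² ≤ ‖h‖ ‖A² h‖`, from an operator `B` that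
plays the role of `A* V`. -/
theorem norm_sq_le_of_inner_eq {A B V : H →L[ℂ] H} (hAB : A * B = B * A)
    (hBV : B * V = V * B) (hV : ∀ h, ‖V h‖ = ‖h‖)
    (h : ∀ x y, ⟪A x, y⟫_ℂ = ⟪V x, B y⟫_ℂ) (x : H) : ‖A x‖ ^ 2 ≤ ‖x‖ * ‖A (A x)‖ := by
  have cAB : ∀ y, A (B y) = B (A y) := fun y => congrArg (fun Z : H →L[ℂ] H => Z y) hAB
  have cBV : ∀ y, B (V y) = V (B y) := fun y => congrArg (fun Z : H →L[ℂ] H => Z y) hBV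
  have hVi : ∀ x y, ⟪V x, V y⟫_ℂ = ⟪x, y⟫_ℂ :=
    (⟨V.toLinearMap, hV⟩ : H →ₗᵢ[ℂ] H).inner_map_map
  -- This is the analogue of `‖A* y‖ = ‖A y‖` for normal operators: the isometry `V` is inserted and
  -- moved past `B`, and the hypothesis `h` is used twice.
  have hB : ∀ y, ‖B y‖ = ‖A y‖ := by
    intro y
    have h1 : ⟪B y, B y⟫_ℂ = ⟪A y, A y⟫_ℂ := by
      calc ⟪B y, B y⟫_ℂ = ⟪V (B y), B (V y)⟫_ℂ := by rw [cBV, hVi]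
        _ = conj ⟪V y, B (A y)⟫_ℂ := by rw [← h, ← cAB, inner_conj_symm]
        _ = ⟪A y, A y⟫_ℂ := by rw [← h, inner_conj_symm]
    rw [inner_self_eq_ofReal_norm_sq, inner_self_eq_ofReal_norm_sq] at h1
    have h3 : ‖B y‖ ^ 2 = ‖A y‖ ^ 2 := by exact_mod_cast h1
    exact (pow_left_inj₀ (norm_nonneg _) (norm_nonneg _) two_ne_zero).1 h3
  have h2 : ‖A x‖ ^ 2 = ‖⟪V x, B (A x)⟫_ℂ‖ := by
    rw [← h, inner_self_eq_ofReal_norm_sq, Complex.norm_real, Real.norm_of_nonneg (sq_nonneg _)]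
  rw [h2]
  refine (norm_inner_le_norm _ _).trans ?_
  rw [hV, hB]

variable [CompleteSpace H]

theorem IsTotalFamily.denseRange {k : X → H} (hk : IsTotalFamily k) :
    DenseRange (Finsupp.linearCombination ℂ k) := by
  have h1 : (LinearMap.range (Finsupp.linearCombination ℂ k))ᗮ = ⊥ := by
    rw [Submodule.eq_bot_iff]
    intro h hh
    refine hk h fun x => ?_
    refine (Submodule.mem_orthogonal _ _).1 hh _ ⟨Finsupp.single x 1, ?_⟩
    simp
  have h2 := (Submodule.topologicalClosure_eq_top_iff).2 h1
  rw [DenseRange, ← LinearMap.coe_range]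
  exact (Submodule.dense_iff_topologicalClosure_eq_top).2 h2

/-- The adjoint of a multiplier has the kernel vectors as eigenvectors, so it is prescribed on their
dense span and extends by the bound. -/
theorem IsTotalFamily.exists_isMultiplier {k : X → H} (hk : IsTotalFamily k) {φ : X → ℂ} {C : ℝ}
    (hC : 0 ≤ C) (h : ∀ c : X →₀ ℂ, ‖Finsupp.linearCombination ℂ (fun x => conj (φ x) • k x) c‖ ≤
      C * ‖Finsupp.linearCombination ℂ k c‖) :
    ∃ A : H →L[ℂ] H, IsMultiplier k φ A ∧ ‖A‖ ≤ C := by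
  set B := (Finsupp.linearCombination ℂ (fun x => conj (φ x) • k x)).extendOfNorm
    (Finsupp.linearCombination ℂ k) with hB
  refine ⟨ContinuousLinearMap.adjoint B, fun x y => ?_, ?_⟩
  · have h1 : B (k x) = conj (φ x) • k x := by
      have := LinearMap.extendOfNorm_eq hk.denseRange ⟨C, h⟩ (Finsupp.single x 1)
      simpa using this
    rw [ContinuousLinearMap.adjoint_inner_right, h1, inner_smul_left, Complex.conj_conj]
  · rw [LinearIsometryEquiv.norm_map]
    exact LinearMap.opNorm_extendOfNorm_le hk.denseRange hC h

/-- Riesz representation of the functional sending `k x` to `conj (F x)`; this is the criterion for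
`F` to belong to the reproducing kernel space. -/
theorem IsTotalFamily.exists_inner_eq {k : X → H} (hk : IsTotalFamily k) {F : X → ℂ} {C : ℝ}
    (h : ∀ c : X →₀ ℂ, ‖Finsupp.linearCombination ℂ (fun x => conj (F x)) c‖ ≤
      C * ‖Finsupp.linearCombination ℂ k c‖) :
    ∃ u : H, ∀ x, F x = ⟪k x, u⟫_ℂ := by
  set B := (Finsupp.linearCombination ℂ (fun x => conj (F x))).extendOfNorm
    (Finsupp.linearCombination ℂ k) with hB
  refine ⟨(InnerProductSpace.toDual ℂ H).symm B, fun x => ?_⟩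
  have h1 : B (k x) = conj (F x) := by
    have := LinearMap.extendOfNorm_eq hk.denseRange ⟨C, h⟩ (Finsupp.single x 1)
    simpa using this
  rw [← inner_conj_symm, InnerProductSpace.toDual_symm_apply, h1, Complex.conj_conj]

theorem IsMultiplier.adjoint_apply {k : X → H} {φ : X → ℂ} {A : H →L[ℂ] H}
    (hA : IsMultiplier k φ A) (x : X) : ContinuousLinearMap.adjoint A (k x) = conj (φ x) • k x := by
  refine ext_inner_right ℂ fun y => ?_
  rw [ContinuousLinearMap.adjoint_inner_left, hA, inner_smul_left, Complex.conj_conj]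

theorem IsMultiplier.posSemidef {k : X → H} {φ : X → ℂ} {A : H →L[ℂ] H}
    (hA : IsMultiplier k φ A) {M : ℝ} (hM : ‖A‖ ≤ M) {ι : Type*} [Fintype ι] (a : ι → X) :
    (Matrix.of fun i j => ((M : ℂ) ^ 2 - φ (a i) * conj (φ (a j))) *
      ⟪k (a i), k (a j)⟫_ℂ).PosSemidef := by
  have key : (Matrix.of fun i j => ((M : ℂ) ^ 2 - φ (a i) * conj (φ (a j))) *
      ⟪k (a i), k (a j)⟫_ℂ) = (Matrix.of fun i j => ⟪(M : ℂ) • k (a i), (M : ℂ) • k (a j)⟫_ℂ) -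
      (Matrix.of fun i j => ⟪conj (φ (a i)) • k (a i), conj (φ (a j)) • k (a j)⟫_ℂ) := by
    ext i j
    simp only [Matrix.of_apply, Matrix.sub_apply, inner_smul_left, inner_smul_right,
      Complex.conj_conj, Complex.conj_ofReal]
    ring
  rw [Matrix.posSemidef_iff_dotProduct_mulVec]
  constructor
  · ext i j
    simp only [Matrix.conjTranspose_apply, Matrix.of_apply, star_mul', star_sub, RCLike.star_def,
      map_pow, Complex.conj_ofReal, Complex.conj_conj, inner_conj_symm]
    ring
  · intro c
    rw [key, Matrix.sub_mulVec, dotProduct_sub, star_dotProduct_gram, star_dotProduct_gram]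
    have h1 : ‖∑ i, c i • conj (φ (a i)) • k (a i)‖ ≤ ‖∑ i, c i • (M : ℂ) • k (a i)‖ := by
      have h2 : ∑ i, c i • conj (φ (a i)) • k (a i) =
          ContinuousLinearMap.adjoint A (∑ i, c i • k (a i)) := by
        rw [map_sum]
        refine Finset.sum_congr rfl fun i _ => ?_
        rw [map_smul, hA.adjoint_apply]
      have h3 : ∑ i, c i • (M : ℂ) • k (a i) = (M : ℂ) • ∑ i, c i • k (a i) := by
        rw [Finset.smul_sum]
        exact Finset.sum_congr rfl fun i _ => smul_comm _ _ _
      rw [h2, h3, norm_smul, Complex.norm_real, Real.norm_of_nonneg ((norm_nonneg _).trans hM)]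
      refine (ContinuousLinearMap.le_opNorm _ _).trans ?_
      rw [LinearIsometryEquiv.norm_map]
      gcongr
    rw [sub_nonneg]
    have h4 := pow_le_pow_left₀ (norm_nonneg _) h1 2
    exact_mod_cast h4

end Multipliers

/-- Parseval on the unit circle, to which the bound extends by continuity. -/
theorem Polynomial.norm_coeff_le_of_forall_disk {q : Polynomial ℂ} {M : ℝ}
    (hM : ∀ t ∈ disk, ‖q.eval t‖ ≤ M) (i : ℕ) : ‖q.coeff i‖ ≤ M := by
  have hM0 : 0 ≤ M := (norm_nonneg _).trans (hM 0 (by simp))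
  have hc : ∀ t ∈ Metric.closedBall (0 : ℂ) 1, ‖q.eval t‖ ≤ M := by
    have hcl : IsClosed {t : ℂ | ‖q.eval t‖ ≤ M} :=
      isClosed_le q.continuous.norm continuous_const
    have := hcl.closure_subset_iff.2 (show disk ⊆ _ from hM)
    rwa [closure_ball (0 : ℂ) one_ne_zero] at this
  by_cases hi : i ∈ q.support
  · have h1 : ‖q.coeff i‖ ^ 2 ≤ Real.circleAverage (fun θ ↦ ‖q.eval θ‖ ^ 2) 0 1 := by
      rw [← q.sum_sq_norm_coeff_eq_circleAverage]
      exact Finset.single_le_sum (f := fun i => ‖q.coeff i‖ ^ 2) (fun _ _ => sq_nonneg _) hi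
    have h2 : Real.circleAverage (fun θ ↦ ‖q.eval θ‖ ^ 2) 0 1 ≤ M ^ 2 := by
      refine Real.circleAverage_mono_on_of_le_circle ?_ fun x hx => ?_
      · exact ContinuousOn.circleIntegrable' (by fun_prop)
      · refine pow_le_pow_left₀ (norm_nonneg _) (hc x ?_) 2
        rw [abs_one] at hx
        exact Metric.sphere_subset_closedBall hx
    exact (pow_le_pow_iff_left₀ (norm_nonneg _) hM0 two_ne_zero).1 (h1.trans h2)
  · rw [Polynomial.notMem_support_iff.1 hi, norm_zero]
    exact hM0

/-! ### Von Neumann inequality for a cusp pair -/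

section VonNeumann

variable {X H : Type*} [NormedAddCommGroup H] [InnerProductSpace ℂ H]

theorem norm_pow_apply_of_isometric {A : H →L[ℂ] H} (hA : ∀ h, ‖A h‖ = ‖h‖) (n : ℕ) (h : H) :
    ‖(A ^ n) h‖ = ‖h‖ := by
  induction n with
  | zero => simp
  | succ n ih => rw [pow_succ', mul_apply_eq_comp, hA, ih]

/-- A pair of commuting isometries that act as multiplication by `τ²` and `τ³`. -/
structure IsCuspPair (k : X → H) (τ : X → ℂ) (S T : H →L[ℂ] H) : Prop where
  total : IsTotalFamily k
  mul_sq : IsMultiplier k (fun x => τ x ^ 2) S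
  mul_cube : IsMultiplier k (fun x => τ x ^ 3) T
  norm_sq : ∀ h, ‖S h‖ = ‖h‖
  norm_cube : ∀ h, ‖T h‖ = ‖h‖

variable {k : X → H} {τ : X → ℂ} {S T : H →L[ℂ] H}

/-- The numerical semigroup generated by 2 and 3 misses only 1. -/
theorem IsCuspPair.exists_pow (h : IsCuspPair k τ S T) (i : ℕ) (hi : i ≠ 1) :
    ∃ R : H →L[ℂ] H, IsMultiplier k (fun x => τ x ^ i) R ∧ ∀ h, ‖R h‖ = ‖h‖ := by
  rcases Nat.even_or_odd' i with ⟨a, rfl | rfl⟩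
  · refine ⟨S ^ a, ?_, norm_pow_apply_of_isometric h.norm_sq a⟩
    simpa only [← pow_mul] using h.mul_sq.pow a
  · obtain ⟨b, rfl⟩ : ∃ b, a = b + 1 := Nat.exists_eq_succ_of_ne_zero (by omega)
    refine ⟨S ^ b * T, ?_, fun x => ?_⟩
    · have := (h.mul_sq.pow b).comp h.mul_cube
      simp only [← pow_mul, ← pow_add] at this
      rwa [show 2 * (b + 1) + 1 = 2 * b + 3 by ring]
    · rw [mul_apply_eq_comp, norm_pow_apply_of_isometric h.norm_sq, h.norm_cube]

/-- The bound only counts coefficients; it is crude, but its factor is linear in the degree, which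
is all that `IsCuspPair.norm_le` needs. -/
theorem IsCuspPair.exists_polynomial (h : IsCuspPair k τ S T) {q : Polynomial ℂ}
    (hq : q.coeff 1 = 0) {M : ℝ} (hM : ∀ t ∈ disk, ‖q.eval t‖ ≤ M) :
    ∃ A : H →L[ℂ] H, IsMultiplier k (fun x => q.eval (τ x)) A ∧ ‖A‖ ≤ (q.natDegree + 1) * M := by
  choose! R hR hRn using h.exists_pow
  have hM0 : 0 ≤ M := (norm_nonneg _).trans (hM 0 (by simp))
  have hi : ∀ i ∈ q.support, i ≠ 1 := by
    rintro i hi rfl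
    exact Polynomial.mem_support_iff.1 hi hq
  refine ⟨∑ i ∈ q.support, q.coeff i • R i, ?_, ?_⟩
  · simpa only [Polynomial.eval_eq_sum, Polynomial.sum_def] using
      IsMultiplier.sum q.support q.coeff fun i hi' => hR i (hi i hi')
  · have h1 : ∀ i ∈ q.support, ‖q.coeff i • R i‖ ≤ M := fun i hi' => by
      rw [norm_smul]
      have : ‖R i‖ ≤ 1 := (R i).opNorm_le_bound zero_le_one fun y => by
        rw [hRn i (hi i hi'), one_mul]
      exact (mul_le_of_le_one_right (norm_nonneg _) this).trans
        (Polynomial.norm_coeff_le_of_forall_disk hM i)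
    refine (norm_sum_le_of_le _ h1).trans ?_
    rw [Finset.sum_const, nsmul_eq_mul]
    gcongr
    exact_mod_cast q.card_supp_le_succ_natDegree

theorem IsCuspPair.norm_sq_le (h : IsCuspPair k τ S T) {q : Polynomial ℂ}
    (hq : q.coeff 1 = 0) {A : H →L[ℂ] H} (hA : IsMultiplier k (fun x => q.eval (τ x)) A) :
    ‖A‖ ^ 2 ≤ ‖A ^ 2‖ := by
  choose! R hR hRn using h.exists_pow
  have hi : ∀ i ∈ q.support, i ≠ 1 := by
    rintro i hi rfl
    exact Polynomial.mem_support_iff.1 hi hq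
  -- The surplus 2 keeps every `N - i` at least 2, away from the missing exponent 1.
  set N := q.natDegree + 2 with hN
  have hNi : ∀ i ∈ q.support, i + (N - i) = N ∧ N - i ≠ 1 := fun i hi' => by
    have := Polynomial.le_natDegree_of_mem_supp i hi'
    omega
  have hV := hR N (by omega)
  -- `B` is the reflected polynomial `∑ conj(qᵢ) τ^(N-i)`. It plays the role of `A* V` with `V`
  -- multiplication by `τ^N`, since on the unit circle `conj(τ^i) τ^N = τ^(N-i)`.
  have hB := IsMultiplier.sum q.support (fun i => conj (q.coeff i))
    (fun i hi' => hR (N - i) (hNi i hi').2)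
  have hAs : A = ∑ i ∈ q.support, q.coeff i • R i := by
    refine hA.unique h.total (IsMultiplier.sum q.support q.coeff fun i hi' => hR i (hi i hi'))
      fun x => ?_
    rw [Polynomial.eval_eq_sum, Polynomial.sum_def]
  have key : ∀ x, ‖A x‖ ^ 2 ≤ ‖x‖ * ‖A (A x)‖ := by
    refine norm_sq_le_of_inner_eq
      ((hA.comp hB).unique h.total (hB.comp hA) fun x => mul_comm _ _)
      ((hB.comp hV).unique h.total (hV.comp hB) fun x => mul_comm _ _)
      (hRn N (by omega)) fun x y => ?_
    rw [hAs, sum_apply, sum_apply, sum_inner, inner_sum]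
    refine Finset.sum_congr rfl fun i hi' => ?_
    obtain ⟨h1, h2⟩ := hNi i hi'
    have h3 : R N = R (N - i) * R i := by
      refine hV.unique h.total ((hR _ h2).comp (hR i (hi i hi'))) fun x => ?_
      rw [← pow_add, add_comm, h1]
    have h4 := (⟨(R (N - i)).toLinearMap, hRn _ h2⟩ : H →ₗᵢ[ℂ] H).inner_map_map (R i x) y
    rw [smul_apply, smul_apply, inner_smul_left, inner_smul_right, h3, mul_apply_eq_comp]
    exact congrArg _ h4.symm
  have h5 : ‖A‖ ≤ Real.sqrt ‖A ^ 2‖ := by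
    refine A.opNorm_le_bound (Real.sqrt_nonneg _) fun x => ?_
    refine (pow_le_pow_iff_left₀ (norm_nonneg _) (by positivity) two_ne_zero).1 ?_
    rw [mul_pow, Real.sq_sqrt (norm_nonneg _)]
    refine (key x).trans ?_
    have h6 : ‖A (A x)‖ ≤ ‖A ^ 2‖ * ‖x‖ := by
      have := (A ^ 2).le_opNorm x
      rwa [pow_two, mul_apply_eq_comp] at this
    nlinarith [norm_nonneg x]
  calc ‖A‖ ^ 2 ≤ Real.sqrt ‖A ^ 2‖ ^ 2 := pow_le_pow_left₀ (norm_nonneg _) h5 2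
    _ = ‖A ^ 2‖ := Real.sq_sqrt (norm_nonneg _)

theorem Polynomial.coeff_one_pow_eq_zero {q : Polynomial ℂ} (hq : q.coeff 1 = 0) (n : ℕ) :
    (q ^ n).coeff 1 = 0 := by
  induction n with
  | zero => simp [Polynomial.coeff_one]
  | succ n ih => rw [pow_succ, Polynomial.mul_coeff_one, ih, hq]; simp

/-- The von Neumann inequality for a pair of commuting isometries with `S³ = T²`. -/
theorem IsCuspPair.norm_le (h : IsCuspPair k τ S T) {q : Polynomial ℂ}
    (hq : q.coeff 1 = 0) {M : ℝ} (hM : ∀ t ∈ disk, ‖q.eval t‖ ≤ M) {A : H →L[ℂ] H}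
    (hA : IsMultiplier k (fun x => q.eval (τ x)) A) : ‖A‖ ≤ M := by
  have hM0 : 0 ≤ M := (norm_nonneg _).trans (hM 0 (by simp))
  have hpow : ∀ n : ℕ, IsMultiplier k (fun x => (q ^ n).eval (τ x)) (A ^ n) := fun n => by
    simpa only [Polynomial.eval_pow] using hA.pow n
  have h1 : ∀ n : ℕ, ‖A‖ ^ (2 ^ n) ≤ ‖A ^ (2 ^ n)‖ := by
    intro n
    induction n with
    | zero => simp
    | succ n ih =>
      rw [pow_succ, pow_mul, pow_mul]
      exact (pow_le_pow_left₀ (by positivity) ih 2).trans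
        (h.norm_sq_le (Polynomial.coeff_one_pow_eq_zero hq _) (hpow _))
  have h2 : ∀ m : ℕ, ‖A ^ m‖ ≤ (m * q.natDegree + 1) * M ^ m := by
    intro m
    have hMm : ∀ t ∈ disk, ‖(q ^ m).eval t‖ ≤ M ^ m := fun t ht => by
      rw [Polynomial.eval_pow, norm_pow]
      exact pow_le_pow_left₀ (norm_nonneg _) (hM t ht) m
    obtain ⟨B, hB, hBn⟩ := h.exists_polynomial (Polynomial.coeff_one_pow_eq_zero hq m) hMm
    rw [(hpow m).unique h.total hB fun _ => rfl]
    refine hBn.trans ?_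
    gcongr
    exact_mod_cast Polynomial.natDegree_pow_le
  by_contra! hlt
  rcases hM0.eq_or_lt with rfl | hMpos
  · have h3 := (h1 0).trans (h2 (2 ^ 0))
    simp only [pow_zero, pow_one, mul_zero] at h3
    exact absurd h3 (not_le.2 hlt)
  -- If `‖A‖ > M`, then `(‖A‖/M)^(2^n)` eventually beats the linear factor `2^n deg q + 1`.
  · have hr : 1 < ‖A‖ / M := (one_lt_div hMpos).2 hlt
    have h3 := (tendsto_pow_const_div_const_pow_of_one_lt 1 hr).const_mul (q.natDegree : ℝ)
    have h4 := h3.add (tendsto_pow_const_div_const_pow_of_one_lt 0 hr)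
    have h5 := h4.comp (tendsto_pow_atTop_atTop_of_one_lt one_lt_two)
    simp only [mul_zero, add_zero] at h5
    obtain ⟨n, hn⟩ := (h5.eventually (gt_mem_nhds one_pos)).exists
    have hpos : 0 < (‖A‖ / M) ^ (2 ^ n) := by positivity
    have h6 : ((2 ^ n : ℕ) * q.natDegree + 1 : ℝ) < (‖A‖ / M) ^ (2 ^ n) := by
      simp only [Function.comp_apply, pow_one, pow_zero] at hn
      rw [mul_div_assoc', ← add_div, div_lt_one hpos] at hn
      linarith
    have h7 := (h1 n).trans (h2 (2 ^ n))
    rw [div_pow, lt_div_iff₀ (by positivity)] at h6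
    exact absurd h7 (not_le.2 h6)

end VonNeumann

/-! ### The vector-valued Hardy space as `ℓ²` with its shift -/

section PowerSums

variable {E : Type*} [NormedAddCommGroup E]

/-- The sequence `(0, h 0, h 1, …)`. -/
def shiftSeq (h : ℕ → E) : ℕ → E
  | 0 => 0
  | n + 1 => h n

theorem memℓp_shiftSeq (h : lp (fun _ : ℕ => E) 2) : Memℓp (shiftSeq h) 2 := by
  rw [memℓp_gen_iff (by norm_num), ← summable_nat_add_iff 1]
  exact (memℓp_gen_iff (by norm_num)).1 (lp.memℓp h)

/-- The unilateral shift on `ℓ²(ℕ, E)`. -/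
noncomputable def shiftIsometry (E : Type*) [NormedAddCommGroup E] [InnerProductSpace ℂ E] :
    lp (fun _ : ℕ => E) 2 →ₗᵢ[ℂ] lp (fun _ : ℕ => E) 2 where
  toFun h := ⟨shiftSeq h, memℓp_shiftSeq h⟩
  map_add' g h := by
    ext n
    cases n with
    | zero => exact (add_zero 0).symm
    | succ n => rfl
  map_smul' c h := by
    ext n
    cases n with
    | zero => exact (smul_zero c).symm
    | succ n => rfl
  norm_map' h := by
    have h2 : (0 : ℝ) < (2 : ENNReal).toReal := by norm_num
    refine (Real.rpow_left_inj (norm_nonneg _) (norm_nonneg _) h2.ne').1 ?_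
    rw [lp.norm_rpow_eq_tsum h2, lp.norm_rpow_eq_tsum h2]
    refine ((memℓp_gen_iff h2).1 (memℓp_shiftSeq h)).tsum_eq_zero_add.trans ?_
    simp [shiftSeq]

variable [InnerProductSpace ℂ E]

/-- The power series with coefficients `h n`. -/
noncomputable def powerSum (h : ℕ → E) (z : ℂ) : E := ∑' n, z ^ n • h n

/-- The power series with coefficients `h n`, as a formal multilinear series. -/
noncomputable def powerSumSeries (h : ℕ → E) : FormalMultilinearSeries ℂ ℂ E :=
  fun n => ContinuousMultilinearMap.mkPiRing ℂ (Fin n) (h n)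

variable [CompleteSpace E]

theorem hasFPowerSeriesOnBall_powerSum (h : lp (fun _ : ℕ => E) 2) :
    HasFPowerSeriesOnBall (powerSum h) (powerSumSeries h) 0 1 := by
  have hr : ((1 : NNReal) : ENNReal) ≤ (powerSumSeries (h : ℕ → E)).radius := by
    refine FormalMultilinearSeries.le_radius_of_bound _ ‖h‖ fun n => ?_
    simpa [powerSumSeries] using lp.norm_apply_le_norm two_ne_zero h n
  have := (powerSumSeries (h : ℕ → E)).hasFPowerSeriesOnBall (lt_of_lt_of_le (by simp) hr)
  have h1 := this.mono (by simp) hr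
  rw [ENNReal.coe_one] at h1
  convert h1 using 1
  ext z
  simp [powerSum, FormalMultilinearSeries.sum, powerSumSeries]

theorem differentiableOn_powerSum (h : lp (fun _ : ℕ => E) 2) :
    DifferentiableOn ℂ (powerSum h) disk := by
  have := (hasFPowerSeriesOnBall_powerSum h).differentiableOn
  rwa [← ENNReal.ofReal_one, Metric.eball_ofReal] at this

theorem hasSum_powerSum (h : lp (fun _ : ℕ => E) 2) {z : ℂ} (hz : ‖z‖ < 1) :
    HasSum (fun n => z ^ n • h n) (powerSum h z) := by
  have := (hasFPowerSeriesOnBall_powerSum h).hasSum (y := z) (by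
    rw [← ENNReal.ofReal_one, Metric.eball_ofReal]
    simpa using hz)
  simpa [powerSumSeries] using this

/-- The identity theorem: the zeros accumulate at 0, so all Taylor coefficients vanish. -/
theorem eq_zero_of_frequently_powerSum_eq_zero (h : lp (fun _ : ℕ => E) 2)
    (hz : ∃ᶠ z in nhdsWithin (0 : ℂ) {0}ᶜ, powerSum h z = 0) : h = 0 := by
  have h1 := (hasFPowerSeriesOnBall_powerSum h).hasFPowerSeriesAt
  have h2 := (h1.analyticAt.frequently_zero_iff_eventually_zero).1 hz
  have h3 : powerSumSeries (h : ℕ → E) = 0 := (h1.congr h2).eq_zero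
  ext n
  have h4 := congrFun h3 n
  exact (ContinuousMultilinearMap.mkPiRing_eq_zero_iff (h n)).1 h4

end PowerSums

/-! ### Kernel vectors of a matrix polynomial `Q` -/

section KernelVectors

variable {p : MvPolynomial (Fin 2) ℂ} {α β : ℕ}

/-- The complex conjugate of a row of `Q x`. -/
noncomputable def rowVector (Q : Matrix (Fin α) (Fin β) (MvPolynomial (Fin 2) ℂ)) (x : Fin 2 → ℂ)
    (i : Fin α) : EuclideanSpace ℂ (Fin β) :=
  WithLp.toLp 2 fun l => conj (evalMat Q x i l)

theorem inner_rowVector (Q : Matrix (Fin α) (Fin β) (MvPolynomial (Fin 2) ℂ)) (x : Fin 2 → ℂ)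
    (i : Fin α) (v : EuclideanSpace ℂ (Fin β)) :
    ⟪rowVector Q x i, v⟫_ℂ = (evalMat Q x).mulVec v i := by
  simp [rowVector, PiLp.inner_apply, Matrix.mulVec, dotProduct, mul_comm]

theorem inner_rowVector_rowVector (Q : Matrix (Fin α) (Fin β) (MvPolynomial (Fin 2) ℂ))
    (x y : Fin 2 → ℂ) (i j : Fin α) :
    ⟪rowVector Q x i, rowVector Q y j⟫_ℂ = (evalMat Q x * (evalMat Q y).conjTranspose) i j := by
  rw [inner_rowVector]
  simp [rowVector, Matrix.mulVec, dotProduct, Matrix.mul_apply]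

theorem memℓp_kernelVector (Q : Matrix (Fin α) (Fin β) (MvPolynomial (Fin 2) ℂ))
    (x : variety p × Fin α) :
    Memℓp (fun n : ℕ => conj (x.1.1 0) ^ n • rowVector Q x.1.1 x.2) 2 := by
  rw [memℓp_gen_iff (by norm_num)]
  have h1 : ‖x.1.1 0‖ < 1 := x.1.2.2.1
  have h2 : Summable fun n : ℕ => (‖x.1.1 0‖ ^ 2) ^ n * ‖rowVector Q x.1.1 x.2‖ ^ 2 :=
    (summable_geometric_of_lt_one (by positivity)
      (pow_lt_one₀ (norm_nonneg _) h1 two_ne_zero)).mul_right _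
  refine h2.congr fun n => ?_
  simp only [norm_smul, norm_pow, RCLike.norm_conj, ENNReal.toReal_ofNat, Real.rpow_ofNat,
    mul_pow]
  ring

/-- The vectors in `ℓ²` whose Gram matrix is the kernel of `Q`. -/
noncomputable def kernelVector (p : MvPolynomial (Fin 2) ℂ)
    (Q : Matrix (Fin α) (Fin β) (MvPolynomial (Fin 2) ℂ)) (x : variety p × Fin α) :
    lp (fun _ : ℕ => EuclideanSpace ℂ (Fin β)) 2 :=
  ⟨fun n : ℕ => conj (x.1.1 0) ^ n • rowVector Q x.1.1 x.2, memℓp_kernelVector Q x⟩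

theorem kernelVector_apply (Q : Matrix (Fin α) (Fin β) (MvPolynomial (Fin 2) ℂ))
    (x : variety p × Fin α) (n : ℕ) :
    kernelVector p Q x n = conj (x.1.1 0) ^ n • rowVector Q x.1.1 x.2 := rfl

/-- Pairing with kernel vectors realizes `h` as the function `Q(z,w) h(z)` on the variety;
orthogonality to all of them means that this function vanishes. -/
theorem inner_kernelVector (Q : Matrix (Fin α) (Fin β) (MvPolynomial (Fin 2) ℂ))
    (x : variety p × Fin α) (h : lp (fun _ : ℕ => EuclideanSpace ℂ (Fin β)) 2) :
    ⟪kernelVector p Q x, h⟫_ℂ = (evalMat Q x.1.1).mulVec (WithLp.ofLp (powerSum h (x.1.1 0))) x.2 := by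
  rw [← inner_rowVector, lp.inner_eq_tsum]
  have h1 := (hasSum_powerSum h x.1.2.2.1).mapL (innerSL ℂ (rowVector Q x.1.1 x.2))
  rw [← innerSL_apply_apply ℂ, ← h1.tsum_eq]
  refine tsum_congr fun n => ?_
  simp [kernelVector_apply, inner_smul_left]

theorem powerSum_kernelVector (Q : Matrix (Fin α) (Fin β) (MvPolynomial (Fin 2) ℂ))
    (x : variety p × Fin α) (z : ℂ) (hz : ‖z‖ < 1) :
    powerSum (kernelVector p Q x) z = (1 - z * conj (x.1.1 0))⁻¹ • rowVector Q x.1.1 x.2 := by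
  have h1 : ‖z * conj (x.1.1 0)‖ < 1 := by
    rw [norm_mul, RCLike.norm_conj]
    exact mul_lt_one_of_nonneg_of_lt_one_left (norm_nonneg _) hz x.1.2.2.1.le
  refine HasSum.tsum_eq ?_
  have h2 := (hasSum_geometric_of_norm_lt_one h1).smul_const (rowVector Q x.1.1 x.2)
  simpa only [kernelVector_apply, smul_smul, mul_pow] using h2

theorem inner_kernelVector_kernelVector (Q : Matrix (Fin α) (Fin β) (MvPolynomial (Fin 2) ℂ))
    (x y : variety p × Fin α) :
    ⟪kernelVector p Q x, kernelVector p Q y⟫_ℂ = pairKernel p Q x.1 y.1 x.2 y.2 := by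
  rw [inner_kernelVector, powerSum_kernelVector Q y _ x.1.2.2.1, ← inner_rowVector,
    inner_smul_right, inner_rowVector_rowVector]
  rfl

theorem powerSum_shiftIsometry (h : lp (fun _ : ℕ => EuclideanSpace ℂ (Fin β)) 2) {z : ℂ}
    (hz : ‖z‖ < 1) : powerSum (shiftIsometry _ h) z = z • powerSum h z := by
  have h1 := (hasSum_powerSum h hz).const_smul z
  have h2 : Summable fun n => z ^ n • shiftSeq (h : ℕ → EuclideanSpace ℂ (Fin β)) n := by
    rw [← summable_nat_add_iff 1]
    refine h1.summable.congr fun n => ?_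
    simp [shiftSeq, smul_smul, pow_succ, mul_comm]
  rw [← h1.tsum_eq]
  change ∑' n, z ^ n • shiftSeq (h : ℕ → EuclideanSpace ℂ (Fin β)) n = _
  rw [h2.tsum_eq_zero_add]
  simp [shiftSeq, smul_smul, pow_succ, mul_comm]

theorem isMultiplier_shiftIsometry (Q : Matrix (Fin α) (Fin β) (MvPolynomial (Fin 2) ℂ)) :
    IsMultiplier (kernelVector p Q) (fun x => x.1.1 0)
      (shiftIsometry (EuclideanSpace ℂ (Fin β))).toContinuousLinearMap := by
  intro x h
  rw [LinearIsometry.coe_toContinuousLinearMap, inner_kernelVector, inner_kernelVector,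
    powerSum_shiftIsometry h x.1.2.2.1]
  simp [Matrix.mulVec_smul]

end KernelVectors

/-! ### Geometry of the cusp `z³ = w²` -/

section Cusp

/-- The parametrization `t ↦ (t², t³)` of the cusp. -/
def cusp (t : ℂ) : Fin 2 → ℂ := ![t ^ 2, t ^ 3]

@[simp] theorem cusp_zero (t : ℂ) : cusp t 0 = t ^ 2 := rfl

@[simp] theorem cusp_one (t : ℂ) : cusp t 1 = t ^ 3 := rfl

theorem mem_zeroSet_neilPoly {x : Fin 2 → ℂ} : x ∈ zeroSet neilPoly ↔ x 0 ^ 3 = x 1 ^ 2 := by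
  simp [zeroSet, neilPoly, sub_eq_zero]

theorem cusp_mem_zeroSet (t : ℂ) : cusp t ∈ zeroSet neilPoly := by
  rw [mem_zeroSet_neilPoly, cusp_zero, cusp_one]
  ring

theorem exists_cusp_eq {x : Fin 2 → ℂ} (hx : x ∈ zeroSet neilPoly) : ∃ t, cusp t = x := by
  rw [mem_zeroSet_neilPoly] at hx
  by_cases h0 : x 0 = 0
  · have h1 : x 1 = 0 := by simpa [h0] using hx.symm
    exact ⟨0, by ext i; fin_cases i <;> simp [h0, h1]⟩
  · refine ⟨x 1 / x 0, ?_⟩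
    ext i
    fin_cases i
    · change (x 1 / x 0) ^ 2 = x 0
      field_simp
      rw [← hx]
    · change (x 1 / x 0) ^ 3 = x 1
      field_simp
      rw [hx]
      ring

theorem zeroLocus_span_neilPoly :
    MvPolynomial.zeroLocus ℂ (Ideal.span {neilPoly}) = zeroSet neilPoly := by
  rw [MvPolynomial.zeroLocus_span]
  ext x
  simp [zeroSet, MvPolynomial.aeval_eq_eval]

/-- Restriction of polynomials to the parametrized cusp. -/
noncomputable def cuspRestrict : MvPolynomial (Fin 2) ℂ →ₐ[ℂ] Polynomial ℂ :=
  MvPolynomial.aeval ![Polynomial.X ^ 2, Polynomial.X ^ 3]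

theorem eval_cuspRestrict (t : ℂ) (q : MvPolynomial (Fin 2) ℂ) :
    (cuspRestrict q).eval t = MvPolynomial.eval (cusp t) q := by
  have : (Polynomial.aeval t).comp cuspRestrict = MvPolynomial.aeval (cusp t) := by
    refine MvPolynomial.algHom_ext fun i => ?_
    fin_cases i <;> simp [cuspRestrict, cusp]
  have h := congrArg (fun φ : MvPolynomial (Fin 2) ℂ →ₐ[ℂ] ℂ => φ q) this
  simpa [MvPolynomial.aeval_eq_eval, Polynomial.coe_aeval_eq_eval] using h

/-- The cusp is irreducible: the kernel of restriction to the parametrization is prime, contains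
`neilPoly`, and lies in the radical by the Nullstellensatz. Minimality forces `J` to be that kernel.
-/
theorem cusp_mem_zeroLocus {J : Ideal (MvPolynomial (Fin 2) ℂ)}
    (hJ : J ∈ (Ideal.span {neilPoly}).minimalPrimes) (t : ℂ) :
    cusp t ∈ MvPolynomial.zeroLocus ℂ J := by
  have hker : RingHom.ker cuspRestrict ≤ J := by
    have h1 : RingHom.ker cuspRestrict ≤ (Ideal.span {neilPoly}).radical := by
      rw [← MvPolynomial.vanishingIdeal_zeroLocus_eq_radical (K := ℂ), zeroLocus_span_neilPoly]
      intro q hq x hx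
      obtain ⟨s, rfl⟩ := exists_cusp_eq hx
      rw [MvPolynomial.aeval_eq_eval, ← eval_cuspRestrict,
        RingHom.mem_ker.1 hq, Polynomial.eval_zero]
    exact h1.trans (hJ.1.1.radical_le_iff.2 hJ.1.2)
  have hle : J ≤ RingHom.ker cuspRestrict := by
    refine hJ.2 ⟨RingHom.ker_isPrime _, ?_⟩ hker
    rw [Ideal.span_singleton_le_iff_mem, RingHom.mem_ker]
    simp [cuspRestrict, neilPoly]
    ring
  intro q hq
  rw [MvPolynomial.aeval_eq_eval, ← eval_cuspRestrict,
    RingHom.mem_ker.1 (hle hq), Polynomial.eval_zero]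

theorem zeroLocus_subset_zeroSet {J : Ideal (MvPolynomial (Fin 2) ℂ)}
    (hJ : J ∈ (Ideal.span {neilPoly}).minimalPrimes) :
    MvPolynomial.zeroLocus ℂ J ⊆ zeroSet neilPoly := by
  rw [← zeroLocus_span_neilPoly]
  exact MvPolynomial.zeroLocus_anti_mono hJ.1.2

theorem exists_minimalPrime_neilPoly : ∃ J, J ∈ (Ideal.span {neilPoly}).minimalPrimes := by
  obtain ⟨J, hJ⟩ := Ideal.nonempty_minimalPrimes (I := Ideal.span {neilPoly}) (by
    intro h
    have h1 := zeroLocus_span_neilPoly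
    rw [h, MvPolynomial.zeroLocus_top] at h1
    exact (h1 ▸ cusp_mem_zeroSet 0 : cusp 0 ∈ (⊥ : Set (Fin 2 → ℂ))))
  exact ⟨J, hJ⟩

theorem degreeOf_zero_neilPoly : neilPoly.degreeOf 0 = 3 := by
  rw [neilPoly, sub_eq_add_neg, MvPolynomial.degreeOf_add_eq_of_degreeOf_lt,
    MvPolynomial.degreeOf_X_self_pow]
  rw [MvPolynomial.degreeOf_neg, MvPolynomial.degreeOf_X_pow_of_ne 2 (by decide),
    MvPolynomial.degreeOf_X_self_pow]
  norm_num

theorem degreeOf_one_neilPoly : neilPoly.degreeOf 1 = 2 := by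
  rw [neilPoly, ← neg_sub, MvPolynomial.degreeOf_neg, sub_eq_add_neg,
    MvPolynomial.degreeOf_add_eq_of_degreeOf_lt, MvPolynomial.degreeOf_X_self_pow]
  rw [MvPolynomial.degreeOf_neg, MvPolynomial.degreeOf_X_pow_of_ne 3 (by decide),
    MvPolynomial.degreeOf_X_self_pow]
  norm_num

end Cusp

/-! ### Generic injectivity of polynomial matrices -/

section GenericRank

open Matrix

/-- Take `d(s) = det (B(s₀)* B(s))`: at `s₀` it is a nonzero Gram determinant, and wherever it is
nonzero `B(s)` has no kernel. -/
theorem Polynomial.exists_mulVec_injective {ι κ : Type*} [Fintype ι] [Fintype κ] [DecidableEq κ]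
    (B : Matrix ι κ (Polynomial ℂ)) (s₀ : ℂ)
    (h₀ : ∀ v, (B.map (Polynomial.eval s₀)).mulVec v = 0 → v = 0) :
    ∃ d : Polynomial ℂ, d ≠ 0 ∧ ∀ s, d.eval s ≠ 0 →
      ∀ v, (B.map (Polynomial.eval s)).mulVec v = 0 → v = 0 := by
  set B₀ := (B.map (Polynomial.eval s₀))ᴴ with hB₀
  have hd : ∀ s, (Matrix.det (B₀.map Polynomial.C * B)).eval s =
      Matrix.det (B₀ * B.map (Polynomial.eval s)) := by
    intro s
    rw [← Polynomial.coe_evalRingHom, RingHom.map_det, RingHom.mapMatrix_apply, Matrix.map_mul]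
    congr 2
    ext i j
    simp
  refine ⟨Matrix.det (B₀.map Polynomial.C * B), ?_, fun s hs v hv => ?_⟩
  · intro h
    have h1 := hd s₀
    rw [h, Polynomial.eval_zero] at h1
    obtain ⟨v, hv, hv0⟩ := Matrix.exists_mulVec_eq_zero_iff.2 h1.symm
    exact hv (h₀ v ((Matrix.conjTranspose_mul_self_mulVec_eq_zero _ _).1 hv0))
  · rw [hd] at hs
    by_contra hv0
    refine hs (Matrix.exists_mulVec_eq_zero_iff.1 ⟨v, hv0, ?_⟩)
    rw [← Matrix.mulVec_mulVec, hv, Matrix.mulVec_zero]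

theorem Matrix.eq_zero_of_vecMul_eq_zero_of_rank_eq {α β : ℕ} {A : Matrix (Fin α) (Fin β) ℂ}
    (hA : A.rank = α) (v : Fin α → ℂ) (hv : v ᵥ* A = 0) : v = 0 := by
  have h1 : LinearIndependent ℂ A.row := by
    rw [linearIndependent_iff_card_eq_finrank_span, Fintype.card_fin, Set.finrank,
      ← Matrix.rank_eq_finrank_span_row, hA]
  refine Matrix.vecMul_injective_iff.2 h1 ?_
  simpa using hv

/-- The stacked matrix is square with two mutually orthogonal blocks of independent rows, so the
Gram inverses give a right inverse, which is also a left inverse. -/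
theorem Matrix.eq_zero_of_mulVec_eq_zero_of_mul_conjTranspose_eq_zero {α : ℕ}
    {A B : Matrix (Fin α) (Fin (2 * α)) ℂ} (hA : ∀ v, v ᵥ* A = 0 → v = 0)
    (hB : ∀ v, v ᵥ* B = 0 → v = 0) (hAB : A * Bᴴ = 0) (v : Fin (2 * α) → ℂ)
    (hAv : A *ᵥ v = 0) (hBv : B *ᵥ v = 0) : v = 0 := by
  have inj : ∀ {C : Matrix (Fin α) (Fin (2 * α)) ℂ}, (∀ v, v ᵥ* C = 0 → v = 0) →
      IsUnit (C * Cᴴ).det := fun {C} hC => by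
    refine (Matrix.isUnit_iff_isUnit_det _).1 (Matrix.PosDef.mul_conjTranspose_self C ?_).isUnit
    intro v w hvw
    refine sub_eq_zero.1 (hC _ ?_)
    rw [Matrix.sub_vecMul]
    exact sub_eq_zero.2 hvw
  have hBA : B * Aᴴ = 0 := by
    have := congrArg Matrix.conjTranspose hAB
    simpa using this
  have h1 : Matrix.fromRows A B * Matrix.fromCols (Aᴴ * (A * Aᴴ)⁻¹) (Bᴴ * (B * Bᴴ)⁻¹) = 1 := by
    rw [Matrix.fromRows_mul_fromCols, ← Matrix.mul_assoc, ← Matrix.mul_assoc, ← Matrix.mul_assoc,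
      ← Matrix.mul_assoc, hAB, hBA, Matrix.mul_nonsing_inv _ (inj hA),
      Matrix.mul_nonsing_inv _ (inj hB), Matrix.zero_mul, Matrix.zero_mul, Matrix.fromBlocks_one]
  have h2 := (Matrix.mul_eq_one_comm_of_card_eq _ _ _ (by simp [two_mul])).1 h1
  rw [← Matrix.one_mulVec v, ← h2, ← Matrix.mulVec_mulVec, Matrix.fromRows_mulVec, hAv, hBv]
  have h3 : Sum.elim (0 : Fin α → ℂ) (0 : Fin α → ℂ) = 0 := by
    ext i
    cases i <;> rfl
  rw [h3, Matrix.mulVec_zero]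

end GenericRank

/-! ### Totality of the kernel vectors -/

section Totality

open Matrix

variable {α : ℕ} {n : ℕ} {P : Matrix (Fin α) (Fin (n * α)) (MvPolynomial (Fin 2) ℂ)}
  {Q : Matrix (Fin α) (Fin (2 * α)) (MvPolynomial (Fin 2) ℂ)}

theorem evalMat_cusp {β : ℕ} (A : Matrix (Fin α) (Fin β) (MvPolynomial (Fin 2) ℂ)) (s : ℂ) :
    evalMat A (cusp s) = (A.map cuspRestrict).map (Polynomial.eval s) := by
  ext i j
  simp [evalMat, eval_cuspRestrict]

/-- The points at `s` and `-s` share `z` and have opposite `w`, so for `|s| = 1` the factor of `P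
P*` is 0 and that of `Q Q*` is 2. This uses the identity outside the bidisk. -/
theorem IsAdmissiblePair.mul_conjTranspose_neg (h : IsAdmissiblePair neilPoly α P Q) {s : ℂ}
    (hs : ‖s‖ = 1) : evalMat Q (cusp s) * (evalMat Q (cusp (-s)))ᴴ = 0 := by
  have h1 := h.identity _ (cusp_mem_zeroSet s) _ (cusp_mem_zeroSet (-s))
  have h2 : s * conj s = 1 := by
    rw [Complex.mul_conj, Complex.normSq_eq_norm_sq, hs]
    simp
  have h3 : (1 - cusp s 0 * conj (cusp (-s) 0)) = 0 := by
    simp only [cusp_zero, map_pow, map_neg]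
    rw [neg_sq, ← mul_pow, h2]
    norm_num
  have h4 : (1 - cusp s 1 * conj (cusp (-s) 1)) = 2 := by
    simp only [cusp_one, map_pow, map_neg]
    rw [Odd.neg_pow (by decide), mul_neg, ← mul_pow, h2]
    norm_num
  rw [h3, h4, zero_smul] at h1
  exact (smul_eq_zero.1 h1).resolve_left two_ne_zero

theorem IsAdmissiblePair.exists_generic_injective (h : IsAdmissiblePair neilPoly α P Q) :
    ∃ d : Polynomial ℂ, d ≠ 0 ∧ ∀ s, d.eval s ≠ 0 → ∀ v, evalMat Q (cusp s) *ᵥ v = 0 →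
      evalMat Q (cusp (-s)) *ᵥ v = 0 → v = 0 := by
  obtain ⟨J, hJ⟩ := exists_minimalPrime_neilPoly
  obtain ⟨x, hx, hxr⟩ := h.rank_Q J hJ
  obtain ⟨s₀, rfl⟩ := exists_cusp_eq (zeroLocus_subset_zeroSet hJ hx)
  obtain ⟨d, hd0, hd⟩ := Polynomial.exists_mulVec_injective (Q.map cuspRestrict)ᵀ s₀ (by
    intro v hv
    rw [Matrix.transpose_map, ← evalMat_cusp, Matrix.mulVec_transpose] at hv
    exact Matrix.eq_zero_of_vecMul_eq_zero_of_rank_eq hxr v hv)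
  have hd' : ∀ s, d.eval s ≠ 0 → ∀ v, v ᵥ* evalMat Q (cusp s) = 0 → v = 0 := by
    intro s hs v hv
    refine hd s hs v ?_
    rwa [Matrix.transpose_map, ← evalMat_cusp, Matrix.mulVec_transpose]
  -- Orthogonality holds only on the circle, so full rank at both `s` and `-s` is needed there;
  -- `d(s) d(-s)` has finitely many roots.
  obtain ⟨s₁, hs₁, hs₁d, hs₁d'⟩ : ∃ s : ℂ, ‖s‖ = 1 ∧ d.eval s ≠ 0 ∧ d.eval (-s) ≠ 0 := by
    have hinf : (Metric.sphere (0 : ℂ) 1).Infinite := by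
      refine (isPreconnected_sphere (by simp [Complex.rank_real_complex]) 0 1).infinite_of_nontrivial
        ⟨1, by simp, -1, by simp, ?_⟩
      norm_num
    have hne : d * d.comp (-Polynomial.X) ≠ 0 := by
      refine mul_ne_zero hd0 fun h0 => hd0 ?_
      have := congrArg (fun q : Polynomial ℂ => q.comp (-Polynomial.X)) h0
      simpa [Polynomial.comp_assoc] using this
    obtain ⟨s, hs, hsr⟩ := hinf.exists_notMem_finset (d * d.comp (-Polynomial.X)).roots.toFinset
    refine ⟨s, by simpa using hs, ?_⟩
    rw [Multiset.mem_toFinset, Polynomial.mem_roots hne, Polynomial.IsRoot, Polynomial.eval_mul,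
      mul_eq_zero, not_or] at hsr
    simpa using hsr
  have hmap : ∀ s : ℂ, (Matrix.fromRows (Q.map cuspRestrict) ((Q.map cuspRestrict).map
      (fun q => q.comp (-Polynomial.X)))).map (Polynomial.eval s) =
      Matrix.fromRows (evalMat Q (cusp s)) (evalMat Q (cusp (-s))) := by
    intro s
    rw [evalMat_cusp, evalMat_cusp]
    ext i j
    cases i <;> simp
  have hsplit : ∀ (s : ℂ) (v : Fin (2 * α) → ℂ),
      Matrix.fromRows (evalMat Q (cusp s)) (evalMat Q (cusp (-s))) *ᵥ v = 0 ↔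
        evalMat Q (cusp s) *ᵥ v = 0 ∧ evalMat Q (cusp (-s)) *ᵥ v = 0 := by
    intro s v
    rw [Matrix.fromRows_mulVec]
    simp [funext_iff]
  obtain ⟨D, hD0, hD⟩ := Polynomial.exists_mulVec_injective
    (Matrix.fromRows (Q.map cuspRestrict) ((Q.map cuspRestrict).map
      (fun q => q.comp (-Polynomial.X)))) s₁ (by
    intro v hv
    rw [hmap, hsplit] at hv
    exact Matrix.eq_zero_of_mulVec_eq_zero_of_mul_conjTranspose_eq_zero (hd' _ hs₁d) (hd' _ hs₁d')
      (h.mul_conjTranspose_neg hs₁) v hv.1 hv.2)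
  refine ⟨D, hD0, fun s hs v hv hv' => hD s hs v ?_⟩
  rw [hmap, hsplit]
  exact ⟨hv, hv'⟩

theorem IsAdmissiblePair.isTotalFamily (h : IsAdmissiblePair neilPoly α P Q) :
    IsTotalFamily (kernelVector neilPoly Q) := by
  intro u hu
  obtain ⟨d, hd0, hd⟩ := h.exists_generic_injective
  refine eq_zero_of_frequently_powerSum_eq_zero u ?_
  have hzero : ∀ t : ℂ, ‖t‖ < 1 → d.eval t ≠ 0 → powerSum u (t ^ 2) = 0 := by
    intro t ht htd
    -- Used at `t` and `-t`, which share the value of `powerSum u` at `t²`.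
    have key : ∀ s : ℂ, ‖s‖ < 1 →
        evalMat Q (cusp s) *ᵥ WithLp.ofLp (powerSum u (s ^ 2)) = 0 := by
      intro s hs
      ext i
      have := hu (neilParam ⟨s, by simpa using hs⟩, i)
      rwa [inner_kernelVector] at this
    have h1 := hd t htd _ (key t ht) (by simpa using key (-t) (by simpa using ht))
    exact (WithLp.ofLp_eq_zero 2).1 h1
  -- Removing 0 makes the complement a neighbourhood of 0 even when `d` vanishes there.
  have hfin : ((fun t : ℂ => t ^ 2) '' (d.roots.toFinset : Set ℂ) \ {0}).Finite :=
    (d.roots.toFinset.finite_toSet.image _).sdiff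
  have hev : ∀ᶠ z in nhdsWithin (0 : ℂ) {0}ᶜ, powerSum u z = 0 := by
    have h1 : ∀ᶠ z in nhds (0 : ℂ), z ∉ ((fun t : ℂ => t ^ 2) '' (d.roots.toFinset : Set ℂ) \ {0}) :=
      hfin.isClosed.isOpen_compl.mem_nhds (by simp)
    have h2 : ∀ᶠ z in nhds (0 : ℂ), ‖z‖ < 1 := by
      filter_upwards [Metric.ball_mem_nhds (0 : ℂ) one_pos] with z hz using by simpa using hz
    filter_upwards [nhdsWithin_le_nhds h1, nhdsWithin_le_nhds h2, self_mem_nhdsWithin]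
      with z hz1 hz2 hz3
    obtain ⟨t, rfl⟩ := IsSquare.exists_sq z (IsAlgClosed.exists_pow_nat_eq z two_pos |>.elim
      fun t ht => ⟨t, by rw [← ht, sq]⟩)
    refine hzero t ?_ fun h0 => hz1 ⟨⟨t, ?_, rfl⟩, hz3⟩
    · rw [norm_pow] at hz2
      exact (pow_lt_one_iff_of_nonneg (norm_nonneg _) two_ne_zero).1 hz2
    · rw [Finset.mem_coe, Multiset.mem_toFinset, Polynomial.mem_roots hd0]
      exact h0
  exact hev.frequently

end Totality

/-! ### Bijectivity of the parametrization -/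

section NeilParam

theorem neilParam_val (t : disk) : (neilParam t).1 = cusp t := rfl

theorem neilParam_bijective : Function.Bijective neilParam := by
  constructor
  · intro s t h
    have h2 : (s : ℂ) ^ 2 = (t : ℂ) ^ 2 := congrFun (congrArg Subtype.val h) 0
    have h3 : (s : ℂ) ^ 3 = (t : ℂ) ^ 3 := congrFun (congrArg Subtype.val h) 1
    ext1
    by_cases ht : (t : ℂ) = 0
    · rw [ht, zero_pow two_ne_zero, pow_eq_zero_iff two_ne_zero] at h2
      rw [h2, ht]
    · rw [pow_succ, h2, pow_succ] at h3
      exact mul_left_cancel₀ (pow_ne_zero 2 ht) h3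
  · rintro ⟨x, hx⟩
    obtain ⟨t, rfl⟩ := exists_cusp_eq hx.1
    have ht : ‖t‖ < 1 := by
      have := hx.2.1
      rw [cusp_zero, norm_pow] at this
      exact (pow_lt_one_iff_of_nonneg (norm_nonneg _) two_ne_zero).1 this
    exact ⟨⟨t, by simpa using ht⟩, rfl⟩

/-- The parametrization of the Neil parabola, as an equivalence. -/
noncomputable def neilEquiv : disk ≃ variety neilPoly :=
  Equiv.ofBijective neilParam neilParam_bijective

theorem cusp_neilEquiv_symm (x : variety neilPoly) : cusp (neilEquiv.symm x) = x.1 :=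
  congrArg Subtype.val (neilEquiv.apply_symm_apply x)

end NeilParam

/-! ### From kernel positivity to operators and back -/

section KernelInequalities

theorem sum_smul_eq_linearCombination {W H : Type*} [DecidableEq W] [AddCommGroup H] [Module ℂ H]
    {α : ℕ} (v : W × Fin α → H) (c : W × Fin α →₀ ℂ) :
    ∑ a : (c.support.image Prod.fst) × Fin α, c (a.1, a.2) • v (a.1, a.2) =
      Finsupp.linearCombination ℂ v c := by
  rw [Finsupp.linearCombination_apply, Finsupp.sum_of_support_subset
    (s := (c.support.image Prod.fst) ×ˢ Finset.univ) c (fun x hx => ?_) _ (by simp),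
    Finset.sum_product, Fintype.sum_prod_type,
    ← Finset.sum_coe_sort (c.support.image Prod.fst)]
  exact Finset.mem_product.2 ⟨Finset.mem_image_of_mem _ hx, Finset.mem_univ _⟩

theorem IsPSDKernel.norm_linearCombination_le {W H H' : Type*} [NormedAddCommGroup H]
    [InnerProductSpace ℂ H] [NormedAddCommGroup H'] [InnerProductSpace ℂ H'] {α : ℕ}
    {L : W → W → Matrix (Fin α) (Fin α) ℂ} (hL : IsPSDKernel L) (v : W × Fin α → H)
    (w : W × Fin α → H')
    (h : ∀ x y i j, L x y i j = ⟪v (x, i), v (y, j)⟫_ℂ - ⟪w (x, i), w (y, j)⟫_ℂ)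
    (c : W × Fin α →₀ ℂ) :
    ‖Finsupp.linearCombination ℂ w c‖ ≤ ‖Finsupp.linearCombination ℂ v c‖ := by
  classical
  have h1 := (Matrix.posSemidef_iff_dotProduct_mulVec.1 (hL (c.support.image Prod.fst))).2
    fun a => c (a.1, a.2)
  have h2 : (Matrix.of fun a b : (c.support.image Prod.fst) × Fin α => L a.1 b.1 a.2 b.2) =
      (Matrix.of fun a b : (c.support.image Prod.fst) × Fin α =>
        ⟪v (a.1, a.2), v (b.1, b.2)⟫_ℂ) -
      (Matrix.of fun a b : (c.support.image Prod.fst) × Fin α =>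
        ⟪w (a.1, a.2), w (b.1, b.2)⟫_ℂ) := by
    ext a b
    exact h _ _ _ _
  rw [h2, Matrix.sub_mulVec, dotProduct_sub,
    star_dotProduct_gram (fun a : (c.support.image Prod.fst) × Fin α => v (a.1, a.2)),
    star_dotProduct_gram (fun a : (c.support.image Prod.fst) × Fin α => w (a.1, a.2)),
    sum_smul_eq_linearCombination, sum_smul_eq_linearCombination, sub_nonneg] at h1
  have h3 : ‖Finsupp.linearCombination ℂ w c‖ ^ 2 ≤ ‖Finsupp.linearCombination ℂ v c‖ ^ 2 := by
    exact_mod_cast h1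
  exact (pow_le_pow_iff_left₀ (norm_nonneg _) (norm_nonneg _) two_ne_zero).1 h3

variable {α n : ℕ} {P : Matrix (Fin α) (Fin (n * α)) (MvPolynomial (Fin 2) ℂ)}

theorem one_sub_mul_conj_ne_zero {z w : ℂ} (hz : ‖z‖ < 1) (hw : ‖w‖ < 1) : 1 - z * conj w ≠ 0 := by
  intro h
  have h1 : ‖z * conj w‖ < 1 := by
    rw [norm_mul, RCLike.norm_conj]
    exact mul_lt_one_of_nonneg_of_lt_one_left (norm_nonneg _) hz hw.le
  rw [← sub_eq_zero.1 h, norm_one] at h1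
  exact lt_irrefl _ h1

/-- Positivity of `P P*` gives the contraction `T`; then `‖u‖ = ‖S³u‖ = ‖T²u‖ ≤ ‖Tu‖` makes it
isometric. -/
theorem IsAdmissiblePair.exists_isCuspPair
    {Q : Matrix (Fin α) (Fin (2 * α)) (MvPolynomial (Fin 2) ℂ)}
    (h : IsAdmissiblePair neilPoly α P Q) :
    ∃ S T, IsCuspPair (kernelVector neilPoly Q) (fun x => (neilEquiv.symm x.1 : ℂ)) S T := by
  have h0 : ∀ x : variety neilPoly, (neilEquiv.symm x : ℂ) ^ 2 = x.1 0 := fun x =>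
    congrFun (cusp_neilEquiv_symm x) 0
  have h1 : ∀ x : variety neilPoly, (neilEquiv.symm x : ℂ) ^ 3 = x.1 1 := fun x =>
    congrFun (cusp_neilEquiv_symm x) 1
  have hS := isMultiplier_shiftIsometry (p := neilPoly) Q
  have hSn : ∀ u, ‖(shiftIsometry (EuclideanSpace ℂ (Fin (2 * α)))).toContinuousLinearMap u‖ =
    ‖u‖ := (shiftIsometry _).norm_map
  obtain ⟨T, hT, hTn⟩ := h.isTotalFamily.exists_isMultiplier (φ := fun x => x.1.1 1)
    zero_le_one fun c => by
      rw [one_mul]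
      refine (isPSDKernel_gram fun x : variety neilPoly => evalMat P x.1).norm_linearCombination_le
        _ _ (fun x y i j => ?_) c
      have h2 := congrFun (congrFun (h.identity x.1 x.2.1 y.1 y.2.1) i) j
      simp only [Matrix.smul_apply, smul_eq_mul] at h2
      rw [inner_smul_left, inner_smul_right, Complex.conj_conj, inner_kernelVector_kernelVector]
      simp only [pairKernel, Matrix.smul_apply, smul_eq_mul]
      have h3 := one_sub_mul_conj_ne_zero x.2.2.1 y.2.2.1
      field_simp
      linear_combination -h2
  refine ⟨_, T, h.isTotalFamily, ?_, ?_, hSn, fun u => ?_⟩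
  · simpa only [h0] using hS
  · simpa only [h1] using hT
  · have hTle : ∀ u, ‖T u‖ ≤ ‖u‖ := fun u =>
      (T.le_opNorm u).trans (mul_le_of_le_one_left (norm_nonneg _) hTn)
    have h2 := (hT.pow 2).unique h.isTotalFamily (hS.pow 3) fun x =>
      (mem_zeroSet_neilPoly.1 x.1.2.1).symm
    refine le_antisymm (hTle u) ?_
    rw [← norm_pow_apply_of_isometric hSn 3 u, ← h2, pow_two, mul_apply_eq_comp]
    exact hTle _

theorem isPSDKernel_polynomial {K : variety neilPoly → variety neilPoly → Matrix (Fin α) (Fin α) ℂ}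
    (hK : IsAdmissibleKernel neilPoly α K) {q : Polynomial ℂ} (hq : q.coeff 1 = 0) {M : ℝ}
    (hM : ∀ t ∈ disk, ‖q.eval t‖ ≤ M) :
    IsPSDKernel fun x y => ((M : ℂ) ^ 2 - q.eval (neilEquiv.symm x : ℂ) *
      conj (q.eval (neilEquiv.symm y : ℂ))) • K x y := by
  obtain ⟨n, m, P, Q, h, rfl⟩ := hK
  obtain rfl : m = 2 := h.degree_w.symm.trans degreeOf_one_neilPoly
  obtain ⟨S, T, hST⟩ := h.exists_isCuspPair
  obtain ⟨A, hA, -⟩ := hST.exists_polynomial hq hM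
  intro F
  have := hA.posSemidef (hST.norm_le hq hM hA) fun a : F × Fin α => ((a.1 : variety neilPoly), a.2)
  simpa only [inner_kernelVector_kernelVector, Matrix.smul_apply, smul_eq_mul] using this

end KernelInequalities

/-! ### From polynomials to bounded holomorphic functions -/

section Approximation

/-- Taylor partial sums converge uniformly on a disk of radius `r' > r`; rescaling by `r` keeps the
linear coefficient zero. -/
theorem exists_polynomial_near_dilation {G : ℂ → ℂ} (hG : DifferentiableOn ℂ G disk)
    (hG0 : deriv G 0 = 0) {r ε : ℝ} (hr0 : 0 ≤ r) (hr : r < 1) (hε : 0 < ε) :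
    ∃ q : Polynomial ℂ, q.coeff 1 = 0 ∧ ∀ t ∈ disk, ‖q.eval t - G (r * t)‖ ≤ ε := by
  obtain ⟨R, hrR, hR1⟩ := exists_between hr
  have hR0 : 0 < R := hr0.trans_lt hrR
  lift R to NNReal using hR0.le
  obtain ⟨r', hrr', hr'R⟩ := exists_between hrR
  lift r' to NNReal using hr0.trans hrr'.le
  have hp := (hG.mono (Metric.closedBall_subset_ball hR1)).hasFPowerSeriesOnBall
    (by exact_mod_cast hR0)
  set p := cauchyPowerSeries G 0 R with hpdef
  have hu := hp.tendstoUniformlyOn (r' := r') (by exact_mod_cast hr'R)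
  obtain ⟨N, hN⟩ := (Metric.tendstoUniformlyOn_iff.1 hu ε hε).exists
  refine ⟨∑ i ∈ Finset.range N, Polynomial.C (p.coeff i * (r : ℂ) ^ i) * Polynomial.X ^ i, ?_,
    fun t ht => ?_⟩
  · have h1 : p.coeff 1 = 0 := by
      have := hp.hasFPowerSeriesAt.deriv
      rw [hG0] at this
      rw [FormalMultilinearSeries.coeff]
      exact this.symm
    rw [Polynomial.finsetSum_coeff]
    refine Finset.sum_eq_zero fun i _ => ?_
    rw [Polynomial.coeff_C_mul_X_pow]
    split_ifs with hi
    · rw [← hi, h1, zero_mul]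
    · rfl
  · have ht1 : ‖t‖ < 1 := by simpa using ht
    have h2 := hN (r * t) (by
      rw [mem_ball_zero_iff, norm_mul, Complex.norm_real, Real.norm_of_nonneg hr0]
      exact (mul_le_of_le_one_right hr0 ht1.le).trans_lt hrr')
    rw [zero_add, dist_comm, dist_eq_norm] at h2
    refine le_of_eq_of_le (congrArg _ (congrArg₂ _ ?_ rfl)) h2.le
    rw [FormalMultilinearSeries.partialSum, Polynomial.eval_finsetSum]
    refine Finset.sum_congr rfl fun i _ => ?_
    rw [FormalMultilinearSeries.apply_eq_pow_smul_coeff]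
    simp
    ring

theorem isKernelBound_of_differentiableOn {G : ℂ → ℂ} (hG : DifferentiableOn ℂ G disk)
    (hG0 : deriv G 0 = 0) {M : ℝ} (hM : ∀ t ∈ disk, ‖G t‖ ≤ M) :
    IsKernelBound neilPoly (fun x => G (neilEquiv.symm x : ℂ)) M := by
  intro α K hK
  set ε : ℕ → ℝ := fun n => 1 / ((n : ℝ) + 1) with hεdef
  have hε0 : ∀ n, 0 < ε n := fun n => Nat.one_div_pos_of_nat
  have hε1 : ∀ n, ε n ≤ 1 := fun n => by
    rw [hεdef]
    exact (div_le_one (by positivity)).2 (by simp)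
  have hεt : Filter.Tendsto ε Filter.atTop (nhds 0) := tendsto_one_div_add_atTop_nhds_zero_nat
  -- The dilation factor is `1 - ε n`, equal to 0 at `n = 0`, and the error is `ε n`.
  choose q hq hqn using fun n => exists_polynomial_near_dilation hG hG0
    (sub_nonneg.2 (hε1 n)) (sub_lt_self _ (hε0 n)) (hε0 n)
  have hdil : ∀ n, ∀ t ∈ disk, ((1 - ε n : ℝ) : ℂ) * t ∈ disk := fun n t ht => by
    rw [mem_ball_zero_iff] at ht ⊢
    rw [norm_mul, Complex.norm_real, Real.norm_of_nonneg (sub_nonneg.2 (hε1 n))]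
    exact (mul_le_of_le_one_left (norm_nonneg _) (by linarith [hε0 n])).trans_lt ht
  have hqM : ∀ n, ∀ t ∈ disk, ‖(q n).eval t‖ ≤ M + ε n := fun n t ht => by
    have h1 := norm_le_norm_add_norm_sub' ((q n).eval t) (G (((1 - ε n : ℝ) : ℂ) * t))
    exact h1.trans (add_le_add (hM _ (hdil n t ht)) (hqn n t ht))
  have hlim : ∀ t ∈ disk, Filter.Tendsto (fun n => (q n).eval t) Filter.atTop (nhds (G t)) := by
    intro t ht
    have h1 : Filter.Tendsto (fun n => ((1 - ε n : ℝ) : ℂ) * t) Filter.atTop (nhds t) := by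
      have h2 : Filter.Tendsto (fun n => ((1 - ε n : ℝ) : ℂ)) Filter.atTop (nhds ((1 - 0 : ℝ) : ℂ)) :=
        (Complex.continuous_ofReal.tendsto _).comp (hεt.const_sub 1)
      simpa using h2.mul_const t
    have h3 := ((hG.differentiableAt (Metric.isOpen_ball.mem_nhds ht)).continuousAt.tendsto).comp h1
    have h4 : Filter.Tendsto (fun n => (q n).eval t - G (((1 - ε n : ℝ) : ℂ) * t)) Filter.atTop
        (nhds 0) := squeeze_zero_norm (fun n => hqn n t ht) hεt
    simpa using h4.add h3
  refine IsPSDKernel.of_tendsto _ (fun n => isPSDKernel_polynomial hK (hq n) (hqM n))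
    fun x y => ?_
  refine Filter.Tendsto.smul_const ?_ _
  have hx := hlim _ (neilEquiv.symm x).2
  have hy := (Complex.continuous_conj.tendsto _).comp (hlim _ (neilEquiv.symm y).2)
  refine Filter.Tendsto.sub ?_ (hx.mul hy)
  have h5 : Filter.Tendsto (fun n => ((M + ε n : ℝ) : ℂ)) Filter.atTop (nhds ((M + 0 : ℝ) : ℂ)) :=
    (Complex.continuous_ofReal.tendsto _).comp (hεt.const_add M)
  simpa using h5.pow 2

end Approximation

/-! ### Rank one pairs and the kernels `k_{a,b}` -/

section RankOne

/-- A row vector of polynomials, as a matrix with one row. -/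
def rowMatrix {n : ℕ} (v : Fin n → MvPolynomial (Fin 2) ℂ) :
    Matrix (Fin 1) (Fin (n * 1)) (MvPolynomial (Fin 2) ℂ) :=
  fun _ j => v (Fin.cast (mul_one n) j)

theorem evalMat_rowMatrix_mul_conjTranspose {n : ℕ} (v : Fin n → MvPolynomial (Fin 2) ℂ)
    (x y : Fin 2 → ℂ) (i j : Fin 1) :
    (evalMat (rowMatrix v) x * (evalMat (rowMatrix v) y).conjTranspose) i j =
      ∑ l, MvPolynomial.eval x (v l) * conj (MvPolynomial.eval y (v l)) := by
  rw [Matrix.mul_apply, ← Equiv.sum_comp (finCongr (mul_one n))]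
  rfl

theorem rank_evalMat_rowMatrix {n : ℕ} (v : Fin n → MvPolynomial (Fin 2) ℂ) (x : Fin 2 → ℂ)
    (l : Fin n) (h : MvPolynomial.eval x (v l) ≠ 0) : (evalMat (rowMatrix v) x).rank = 1 := by
  have h1 : LinearIndependent ℂ (evalMat (rowMatrix v) x).row := by
    rw [linearIndependent_unique_iff]
    intro h0
    exact h (congrFun h0 (Fin.cast (mul_one n).symm l))
  rw [h1.rank_matrix, Fintype.card_fin]

theorem isAdmissiblePair_rowMatrix (u : Fin 2 → MvPolynomial (Fin 2) ℂ)
    (v : Fin 3 → MvPolynomial (Fin 2) ℂ) (t : ℂ) (i : Fin 2) (j : Fin 3)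
    (hu : MvPolynomial.eval (cusp t) (u i) ≠ 0) (hv : MvPolynomial.eval (cusp t) (v j) ≠ 0)
    (h : ∀ s t : ℂ, (1 - s ^ 3 * conj (t ^ 3)) * ∑ l, MvPolynomial.eval (cusp s) (u l) *
        conj (MvPolynomial.eval (cusp t) (u l)) =
      (1 - s ^ 2 * conj (t ^ 2)) * ∑ l, MvPolynomial.eval (cusp s) (v l) *
        conj (MvPolynomial.eval (cusp t) (v l))) :
    IsAdmissiblePair neilPoly 1 (rowMatrix v) (rowMatrix u) where
  rank_pos := one_pos
  degree_z := degreeOf_zero_neilPoly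
  degree_w := degreeOf_one_neilPoly
  rank_Q _ hJ := ⟨cusp t, cusp_mem_zeroLocus hJ t, rank_evalMat_rowMatrix u _ i hu⟩
  rank_P _ hJ := ⟨cusp t, cusp_mem_zeroLocus hJ t, rank_evalMat_rowMatrix v _ j hv⟩
  identity := by
    intro x hx y hy
    obtain ⟨s, rfl⟩ := exists_cusp_eq hx
    obtain ⟨t, rfl⟩ := exists_cusp_eq hy
    ext a b
    simp only [Matrix.smul_apply, smul_eq_mul, evalMat_rowMatrix_mul_conjTranspose]
    exact h s t

open MvPolynomial in
theorem exists_isAdmissibleKernel_dprs (a b : ℂ) (hab : ‖a‖ ^ 2 + ‖b‖ ^ 2 = 1) :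
    ∃ K : variety neilPoly → variety neilPoly → Matrix (Fin 1) (Fin 1) ℂ,
      IsAdmissibleKernel neilPoly 1 K ∧
      ∀ s t : disk, K (neilParam s) (neilParam t) 0 0 =
        (s : ℂ) ^ 2 * dprsKernel a b s t * conj ((t : ℂ) ^ 2) := by
  have hab' : a * conj a + b * conj b = 1 := by
    rw [Complex.mul_conj, Complex.mul_conj, Complex.normSq_eq_norm_sq, Complex.normSq_eq_norm_sq]
    exact_mod_cast hab
  -- A point where the common first entry `t²(a + bt)` of `u` and `v` is nonzero, for the rank
  -- conditions.
  obtain ⟨t, ht0, ht⟩ : ∃ t : ℂ, t ≠ 0 ∧ a + b * t ≠ 0 := by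
    by_cases h1 : a + b * 1 = 0
    · refine ⟨-1, by norm_num, fun h2 => ?_⟩
      have ha : a = 0 := by linear_combination (h1 + h2) / 2
      have hb : b = 0 := by linear_combination (h1 - h2) / 2
      simp [ha, hb] at hab
    · exact ⟨1, one_ne_zero, h1⟩
  -- On the cusp the entries of `u` are `t²(a + bt)` and `t⁴(b̄ - āt)`, those of `v` are `t²(a +
  -- bt)`, `t⁴` and `t⁵(b̄ - āt)`. Both identities rest on `(a + bs)conj(a + bt) + (b̄ - ās)conj(b̄
  -- - āt) = 1 + s t̄`, where `|a|² + |b|² = 1` enters.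
  set u : Fin 2 → MvPolynomial (Fin 2) ℂ :=
    ![C a * X 0 + C b * X 1, C (conj b) * X 0 ^ 2 - C (conj a) * X 0 * X 1] with hu
  set v : Fin 3 → MvPolynomial (Fin 2) ℂ :=
    ![C a * X 0 + C b * X 1, X 0 ^ 2, C (conj b) * X 0 * X 1 - C (conj a) * X 0 ^ 3] with hv
  have hne : eval (cusp t) (C a * X 0 + C b * X 1) ≠ 0 := by
    have : eval (cusp t) (C a * X 0 + C b * X 1) = t ^ 2 * (a + b * t) := by
      simp
      ring
    rw [this]
    exact mul_ne_zero (pow_ne_zero 2 ht0) ht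
  have hadm := isAdmissiblePair_rowMatrix u v t 0 0 hne hne (by
    intro s t
    simp only [hu, hv, Fin.sum_univ_two, Fin.sum_univ_three, Matrix.cons_val, map_add, map_sub,
      map_mul, map_pow, eval_C, eval_X, cusp_zero, cusp_one, Complex.conj_conj]
    linear_combination (s * conj t) ^ 4 * (1 - (s * conj t) ^ 2) * hab')
  refine ⟨_, ⟨3, 2, rowMatrix v, rowMatrix u, hadm, rfl⟩, fun s t => ?_⟩
  have hs1 : ‖(s : ℂ)‖ < 1 := mem_ball_zero_iff.1 s.2
  have ht1 : ‖(t : ℂ)‖ < 1 := mem_ball_zero_iff.1 t.2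
  have h1 := one_sub_mul_conj_ne_zero hs1 ht1
  have h2 := one_sub_mul_conj_ne_zero (neilParam s).2.2.1 (neilParam t).2.2.1
  rw [pairKernel, Matrix.smul_apply, smul_eq_mul, evalMat_rowMatrix_mul_conjTranspose,
    inv_mul_eq_iff_eq_mul₀ h2]
  simp only [neilParam_val, hu, Fin.sum_univ_two, Matrix.cons_val, map_add, map_sub,
      map_mul, map_pow, eval_C, eval_X, cusp_zero, cusp_one, Complex.conj_conj, dprsKernel]
  have h3 : (s : ℂ) ^ 2 * conj (t : ℂ) ^ 2 / (1 - s * conj (t : ℂ)) *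
      (1 - (s : ℂ) ^ 2 * conj (t : ℂ) ^ 2) =
      (s : ℂ) ^ 2 * conj (t : ℂ) ^ 2 * (1 + s * conj (t : ℂ)) := by
    field_simp
    ring
  linear_combination (s * conj (t : ℂ)) ^ 4 * (1 + s * conj (t : ℂ)) * hab' -
    (s * conj (t : ℂ)) ^ 2 * h3

end RankOne

/-! ### Kernel bounds force membership in the constrained algebra -/

section NeilMultipliers

open MvPolynomial in
-- With `x = s t̄` its kernel is `(1 + x³)/(1 - x²) = 1 + x²/(1 - x)`, the reproducing kernel of the
-- functions in `H²` with `f'(0) = 0`.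
theorem isAdmissiblePair_one_cusp : IsAdmissiblePair neilPoly 1
    (rowMatrix ![1, X 0, X 0 ^ 2]) (rowMatrix ![1, X 1]) := by
  refine isAdmissiblePair_rowMatrix _ _ 0 0 0 (by simp) (by simp) fun s t => ?_
  simp [Fin.sum_univ_two, Fin.sum_univ_three]
  ring

open MvPolynomial in
theorem pairKernel_one_cusp (x y : variety neilPoly) (i j : Fin 1) :
    pairKernel neilPoly (rowMatrix ![1, X 1]) x y i j =
      (1 + x.1 1 * conj (y.1 1)) / (1 - x.1 0 * conj (y.1 0)) := by
  rw [pairKernel, Matrix.smul_apply, smul_eq_mul, evalMat_rowMatrix_mul_conjTranspose]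
  simp [Fin.sum_univ_two]
  ring

open MvPolynomial in
theorem IsKernelBound.norm_le {f : variety neilPoly → ℂ} {M : ℝ} (hM : 0 ≤ M)
    (hf : IsKernelBound neilPoly f M) (x : variety neilPoly) : ‖f x‖ ≤ M := by
  have h1 := ((hf 1 _ ⟨3, 2, _, _, isAdmissiblePair_one_cusp, rfl⟩) {x}).diag_nonneg
    (i := (⟨x, by simp⟩, 0))
  simp only [Matrix.of_apply, Matrix.smul_apply, smul_eq_mul, pairKernel_one_cusp] at h1
  have h2 : ((M : ℂ) ^ 2 - f x * conj (f x)) *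
      ((1 + x.1 1 * conj (x.1 1)) / (1 - x.1 0 * conj (x.1 0))) =
      (((M ^ 2 - ‖f x‖ ^ 2) * ((1 + ‖x.1 1‖ ^ 2) / (1 - ‖x.1 0‖ ^ 2)) : ℝ) : ℂ) := by
    simp only [Complex.mul_conj, Complex.normSq_eq_norm_sq]
    push_cast
    ring
  rw [h2] at h1
  have h3 : 0 ≤ (M ^ 2 - ‖f x‖ ^ 2) * ((1 + ‖x.1 1‖ ^ 2) / (1 - ‖x.1 0‖ ^ 2)) := by
    exact_mod_cast h1
  have h4 : 0 < (1 + ‖x.1 1‖ ^ 2) / (1 - ‖x.1 0‖ ^ 2) :=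
    div_pos (by positivity) (sub_pos.2 (pow_lt_one₀ (norm_nonneg _) x.2.2.1 two_ne_zero))
  have h5 := nonneg_of_mul_nonneg_left h3 h4
  exact (pow_le_pow_iff_left₀ (norm_nonneg _) hM two_ne_zero).1 (sub_nonneg.1 h5)

open MvPolynomial in
theorem IsKernelBound.exists_inner_eq {f : variety neilPoly → ℂ} {M : ℝ} (hM : 0 ≤ M)
    (hf : IsKernelBound neilPoly f M) :
    ∃ u, ∀ x, f x = ⟪kernelVector neilPoly (rowMatrix ![1, X 1]) (x, 0), u⟫_ℂ := by
  have hadm := isAdmissiblePair_one_cusp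
  -- The second kernel is `K - 1`, since `Q = (z, w)` gives `(z ζ̄ + w η̄)/(1 - z ζ̄)`. So the sum
  -- `(M² - f f̄) K + f f̄ (K - 1)` is `M² K - f f̄`, whose positivity puts `f` in the space of `K`.
  have h1 := (hf 1 _ ⟨3, 2, _, _, hadm, rfl⟩).add
    ((isPSDKernel_pairKernel neilPoly (rowMatrix ![X 0, X 1])).sandwich f)
  obtain ⟨u, hu⟩ := hadm.isTotalFamily.exists_inner_eq (F := fun x => f x.1) (C := M)
    fun c => by
      have h2 := h1.norm_linearCombination_le
        (fun x => (M : ℂ) • kernelVector neilPoly (rowMatrix ![1, X 1]) x)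
        (fun x => conj (f x.1)) (fun x y i j => ?_) c
      · refine h2.trans_eq ?_
        have h3 : Finsupp.linearCombination ℂ
            (fun x => (M : ℂ) • kernelVector neilPoly (rowMatrix ![1, X 1]) x) c =
            (M : ℂ) • Finsupp.linearCombination ℂ
              (kernelVector neilPoly (rowMatrix ![1, X 1])) c := by
          simp only [Finsupp.linearCombination_apply, Finsupp.smul_sum]
          exact Finsupp.sum_congr fun x _ => smul_comm _ _ _
        rw [h3, norm_smul, Complex.norm_real, Real.norm_of_nonneg hM]
      · have h4 := one_sub_mul_conj_ne_zero x.2.2.1 y.2.2.1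
        rw [inner_smul_left, inner_smul_right, inner_kernelVector_kernelVector]
        simp only [Matrix.add_apply, Matrix.smul_apply, smul_eq_mul, pairKernel_one_cusp]
        rw [pairKernel, Matrix.smul_apply, smul_eq_mul, evalMat_rowMatrix_mul_conjTranspose]
        simp [Fin.sum_univ_two]
        field_simp
        ring
  exact ⟨u, fun x => hu (x, 0)⟩

open MvPolynomial in
theorem IsKernelBound.mem_constrainedHInfty {f : variety neilPoly → ℂ} {M : ℝ} (hM : 0 ≤ M)
    (hf : IsKernelBound neilPoly f M) : f ∘ neilEquiv ∈ constrainedHInfty := by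
  obtain ⟨u, hu⟩ := hf.exists_inner_eq hM
  set a : ℂ → ℂ := fun z => powerSum u z 0 with ha
  set b : ℂ → ℂ := fun z => powerSum u z 1 with hb
  have hd : ∀ i : Fin (2 * 1), DifferentiableOn ℂ (fun z => powerSum u z i) disk := fun i =>
    (EuclideanSpace.proj (𝕜 := ℂ) i).differentiable.comp_differentiableOn
      (differentiableOn_powerSum u)
  have hsq : Set.MapsTo (fun t : ℂ => t ^ 2) disk disk := fun t ht => by
    rw [mem_ball_zero_iff] at ht ⊢
    rw [norm_pow]
    exact pow_lt_one₀ (norm_nonneg _) ht two_ne_zero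
  have hda : DifferentiableOn ℂ (fun t => a (t ^ 2)) disk :=
    (hd 0).comp (by fun_prop) hsq
  have hdb : DifferentiableOn ℂ (fun t => b (t ^ 2)) disk :=
    (hd 1).comp (by fun_prop) hsq
  have hval : ∀ t : disk, f (neilEquiv t) = a ((t : ℂ) ^ 2) + (t : ℂ) ^ 3 * b ((t : ℂ) ^ 2) := by
    intro t
    rw [hu, inner_kernelVector, Matrix.mulVec, dotProduct]
    refine (Fin.sum_univ_two (M := ℂ) _).trans ?_
    change eval (cusp t) 1 * a ((t : ℂ) ^ 2) + eval (cusp t) (X 1) * b ((t : ℂ) ^ 2) = _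
    rw [map_one, eval_X, cusp_one, one_mul]
  have h0 : disk ∈ nhds (0 : ℂ) := Metric.ball_mem_nhds _ one_pos
  refine ⟨fun t => a (t ^ 2) + t ^ 3 * b (t ^ 2), hda.add (DifferentiableOn.mul (by fun_prop) hdb),
    ⟨M, fun t ht => ?_⟩, ?_, hval⟩
  · exact (congrArg norm (hval ⟨t, ht⟩)).symm.trans_le (hf.norm_le hM _)
  -- Neither `a(t²)` nor `t³ b(t²)` has a linear term at 0.
  · have h1 : HasDerivAt (fun t : ℂ => a (t ^ 2)) 0 0 := by
      have h2 : HasDerivAt a (deriv a 0) ((0 : ℂ) ^ 2) := by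
        rw [zero_pow two_ne_zero]
        exact ((hd 0).differentiableAt h0).hasDerivAt
      simpa [Function.comp_def] using! h2.comp (0 : ℂ) (hasDerivAt_pow 2 (0 : ℂ))
    have h3 : HasDerivAt (fun t : ℂ => t ^ 3 * b (t ^ 2)) 0 0 := by
      simpa using! (hasDerivAt_pow 3 (0 : ℂ)).mul (hdb.differentiableAt h0).hasDerivAt
    simpa using! (h1.add h3).deriv

end NeilMultipliers

/-! ### The isometric isomorphism -/

section Isomorphism

/-- Composition with the parametrization, as an isomorphism of function algebras. -/
noncomputable def cuspPullback : (variety neilPoly → ℂ) ≃ₐ[ℂ] (disk → ℂ) :=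
  AlgEquiv.piCongrLeft' ℂ (fun _ => ℂ) neilEquiv.symm

theorem isKernelBound_of_forall_norm_le {f : variety neilPoly → ℂ}
    (hf : f ∘ neilEquiv ∈ constrainedHInfty) {M : ℝ} (hM : ∀ x, ‖f x‖ ≤ M) :
    IsKernelBound neilPoly f M := by
  obtain ⟨G, hG, -, hG0, hfG⟩ := hf
  have h1 : f = fun x => G (neilEquiv.symm x : ℂ) := by
    ext x
    rw [← hfG, Function.comp_apply, Equiv.apply_symm_apply]
  rw [h1]
  refine isKernelBound_of_differentiableOn hG hG0 fun t ht => ?_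
  rw [← hfG ⟨t, ht⟩]
  exact hM _

theorem map_HInftyK_neilPoly :
    (HInftyK neilPoly).map (cuspPullback : (variety neilPoly → ℂ) →ₐ[ℂ] (disk → ℂ)) =
      constrainedHInfty := by
  ext g
  rw [Subalgebra.mem_map]
  constructor
  · rintro ⟨f, ⟨M, hM, hf⟩, rfl⟩
    exact hf.mem_constrainedHInfty hM.le
  · intro hg
    have hgf : (cuspPullback.symm g) ∘ neilEquiv = g := cuspPullback.apply_symm_apply g
    refine ⟨cuspPullback.symm g, ?_, cuspPullback.apply_symm_apply g⟩
    obtain ⟨G, -, ⟨C, hC⟩, -, hgG⟩ := id hg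
    -- `C` may be 0, while a kernel bound must be positive.
    refine ⟨max C 1, lt_max_of_lt_right one_pos, ?_⟩
    refine isKernelBound_of_forall_norm_le (by rwa [hgf]) fun x => ?_
    obtain ⟨t, rfl⟩ := neilEquiv.surjective x
    have h1 := congrFun hgf t
    rw [Function.comp_apply] at h1
    rw [h1, hgG]
    exact (hC t t.2).trans (le_max_left _ _)

theorem isLUB_kernelNorm {f : variety neilPoly → ℂ} (hf : f ∈ HInftyK neilPoly) :
    IsLUB (Set.range fun t : disk => ‖f (neilEquiv t)‖) (kernelNorm neilPoly f) := by
  obtain ⟨M₀, hM₀, hfM₀⟩ := hf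
  constructor
  · rintro _ ⟨t, rfl⟩
    exact le_csInf ⟨M₀, hM₀, hfM₀⟩ fun M hM => hM.2.norm_le hM.1.le _
  · intro C hC
    have hC' : ∀ x, ‖f x‖ ≤ C := fun x => by
      obtain ⟨t, rfl⟩ := neilEquiv.surjective x
      exact hC ⟨t, rfl⟩
    have hC0 : 0 ≤ C := (norm_nonneg _).trans (hC' (neilParam ⟨0, by simp⟩))
    -- The slack `ε` makes `C + ε` an admissible positive bound even for `C = 0`.
    refine le_of_forall_pos_le_add fun ε hε => csInf_le ⟨0, fun M hM => hM.1.le⟩ ?_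
    exact ⟨by positivity, isKernelBound_of_forall_norm_le (hfM₀.mem_constrainedHInfty hM₀.le)
      fun x => (hC' x).trans (le_add_of_nonneg_right hε.le)⟩

end Isomorphism

theorem mainTheorem8 :
    (∃ e : HInftyK neilPoly ≃ₐ[ℂ] constrainedHInfty,
      ∀ f : HInftyK neilPoly,
        (∀ t : disk, (e f : disk → ℂ) t = (f : variety neilPoly → ℂ) (neilParam t)) ∧
        IsLUB (Set.range fun t : disk => ‖(e f : disk → ℂ) t‖)
          (kernelNorm neilPoly (f : variety neilPoly → ℂ))) ∧
    (∀ a b : ℂ, ‖a‖ ^ 2 + ‖b‖ ^ 2 = 1 →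
      ∃ K : variety neilPoly → variety neilPoly → Matrix (Fin 1) (Fin 1) ℂ,
        IsAdmissibleKernel neilPoly 1 K ∧
        ∀ s t : disk, K (neilParam s) (neilParam t) 0 0 =
          (s : ℂ) ^ 2 * dprsKernel a b s t * conj ((t : ℂ) ^ 2)) := by
  refine ⟨⟨(cuspPullback.subalgebraMap (HInftyK neilPoly)).trans
    (Subalgebra.equivOfEq _ _ map_HInftyK_neilPoly), fun f => ⟨fun t => rfl, ?_⟩⟩,
    exists_isAdmissibleKernel_dprs⟩
  exact isLUB_kernelNorm f.2
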